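/- Let $\alpha\in(0,1)$. The Fourier transform is $\hat f(\xi)=\int_{\mathbb R} f(x)e^{-ix\xi}\,dx$ for Schwartz functions $f$, extended by duality to tempered distributions on $\mathbb R$. Let $K_\alpha$ be the tempered distribution with $$\widehat{K_\alpha}(\xi)=\left(\frac{\tanh \xi}{\xi}\right)^{\alpha}\quad(\xi\neq0),\qquad \widehat{K_\alpha}(0)=1 .$$ Then $K_\alpha$ is given by a real-valued function on $\mathbb R$, unique up to null sets, which (for a suitable representative) has the following properties. (i) $K_\alpha$ is of class $C^\infty$ on $\mathbb R\setminus\{0\}$, and for every real $N\ge 1$ there is a constant $C=C(\alpha,N)>0$ such that $|K_\alpha(x)|\le C x^{-N}$ for all $x>0$. (ii) $K_\alpha$ is bell-shaped: for every $p$ with $1\le p<1/(1-\alpha)$ it lies in the $L^p(\mathbb R)$-closure of the set of even, continuous, positive functions in $L^p(\mathbb R)$ that are decreasing on the positive half-axis. Moreover $K_\alpha$ is itself even, positive on $\mathbb R\setminus\{0\}$, and strictly decreasing on $(0,\infty)$; and it is strictly convex on each of $(0,\infty)$ and $(-\infty,0)$. (iii) $\|K_\alpha\|_{L^1}=\int_{\mathbb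 R}K_\alpha(x)\,dx=\widehat{K_\alpha}(0)=1$, and for every $1\le p\le\infty$ the convolution operator $f\mapsto K_\alpha * f$ on the real-valued functions in $L^p(\mathbb R)$ has operator norm $1$. (iv) For $0<p\le\infty$, $K_\alpha\in L^p(\mathbb R)$ if and only if $p<1/(1-\alpha)$. (In particular, $K_{1/4}\in L^p(\mathbb R)$ for all $0<p<4/3$.) -/

import Mathlib

open MeasureTheory Set
open scoped SchwartzMap ENNReal ContDiff

noncomputable section

/-- The symbol `(tanh ξ / ξ) ^ α`, with its continuous extension `1` at `ξ = 0`. -/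
def tanhSymbol (α ξ : ℝ) : ℝ :=
  if ξ = 0 then 1 else (Real.tanh ξ / ξ) ^ α

/-- Multiplication by `1 / (2π)` on the real line. -/
def frequencyScaling : ℝ ≃L[ℝ] ℝ :=
  ContinuousLinearEquiv.unitsEquivAut ℝ
    (Units.mk0 ((2 * Real.pi)⁻¹) (inv_ne_zero Real.two_pi_pos.ne'))

/-- The Fourier transform `φ ↦ (ξ ↦ ∫ φ(x) e^{-ixξ} dx)` on Schwartz functions, obtained from the
one of Mathlib (which has `e^{-2πixξ}`) by scaling the frequency;
see `angularFourierSchwartz_apply`. -/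
def angularFourierSchwartz : 𝓢(ℝ, ℂ) →L[ℂ] 𝓢(ℝ, ℂ) :=
  (SchwartzMap.compCLMOfContinuousLinearEquiv ℂ frequencyScaling).comp
    (FourierTransform.fourierCLM ℂ 𝓢(ℝ, ℂ))

theorem angularFourierSchwartz_apply (φ : 𝓢(ℝ, ℂ)) (ξ : ℝ) :
    angularFourierSchwartz φ ξ = ∫ x : ℝ, φ x * Complex.exp (-Complex.I * x * ξ) := by
  have h : angularFourierSchwartz φ ξ
      = FourierTransform.fourier (φ : ℝ → ℂ) (frequencyScaling ξ) := by
    rw [← SchwartzMap.fourier_coe]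
    rfl
  rw [h, Real.fourier_eq']
  refine integral_congr_ae (Filter.Eventually.of_forall fun x => ?_)
  have hs : frequencyScaling ξ = ξ * (2 * Real.pi)⁻¹ := rfl
  have hpi : (Real.pi : ℂ) ≠ 0 := by exact_mod_cast Real.pi_ne_zero
  simp only [hs, smul_eq_mul]
  rw [mul_comm]
  congr 2
  simp
  field_simp

/-- The Fourier transform of tempered distributions, by duality: `(F T)(φ) = T (F φ)`. -/
def angularFourier (T : 𝓢'(ℝ, ℂ)) : 𝓢'(ℝ, ℂ) :=
  PointwiseConvergenceCLM.precomp ℂ angularFourierSchwartz T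

theorem angularFourier_apply (T : 𝓢'(ℝ, ℂ)) (φ : 𝓢(ℝ, ℂ)) :
    angularFourier T φ = T (angularFourierSchwartz φ) := rfl

/-- The tempered distribution `T` is the function `f`: `T φ = ∫ φ f`, with absolutely convergent
integrals, for all Schwartz functions `φ`. -/
def IsGivenBy (T : 𝓢'(ℝ, ℂ)) (f : ℝ → ℝ) : Prop :=
  ∀ φ : 𝓢(ℝ, ℂ), Integrable (fun x : ℝ => φ x * (f x : ℂ)) ∧
    T φ = ∫ x : ℝ, φ x * (f x : ℂ)

/-- The function `K`, as a tempered distribution, has Fourier transform `(tanh ξ / ξ) ^ α`. -/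
def IsTanhKernel (α : ℝ) (K : ℝ → ℝ) : Prop :=
  ∃ T : 𝓢'(ℝ, ℂ), IsGivenBy T K ∧ IsGivenBy (angularFourier T) (tanhSymbol α)

/-- Bell-shaped elements of `L^p(ℝ)`: those in the `L^p`-closure of the set of even, continuous and
positive functions that are decreasing on the positive half-axis. -/
def IsBellShaped (p : ℝ≥0∞) (f : ℝ → ℝ) : Prop :=
  MemLp f p ∧ ∀ ε : ℝ≥0∞, 0 < ε → ∃ g : ℝ → ℝ,
    MemLp g p ∧ Continuous g ∧ (∀ x, g (-x) = g x) ∧ (∀ x, 0 < g x) ∧ AntitoneOn g (Ici 0) ∧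
      eLpNorm (fun x => f x - g x) p < ε

/-- `C` bounds the operator `f ↦ K * f` on `L^p(ℝ)`. -/
def IsConvolutionBound (K : ℝ → ℝ) (p C : ℝ≥0∞) : Prop :=
  ∀ f : ℝ → ℝ, MemLp f p →
    eLpNorm (fun x : ℝ => ∫ y : ℝ, K (x - y) * f y) p ≤ C * eLpNorm f p

end

/-! The symbol is a superposition of the functions `2s / (s² + ξ²)`, each of which is the Fourier
transform of `exp (-s|x|)`. There is a positive measure `μ` on the half-line with `(tanh ξ / ξ)^α =
∫ 2s / (s² + ξ²) dμ(s)`, so the kernel is `K(x) = ∫ exp (-s|x|) dμ(s)`, a Laplace transform in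
`|x|`. Evenness, positivity, monotonicity, strict convexity and smoothness off the origin are
inherited from the exponentials.

The measure comes from Cauchy's theorem. The function `m(z) = (tanh z / z)^α` is holomorphic for `Re
z > 0`, because `tanh z / z` maps the open first quadrant into the lower half-plane and hence avoids
the cut of the power. The difference quotient `(2z m(z) - 2ξ m(ξ)) / (z² - ξ²)` has no pole and
decays like `|z|^(-1-α)` off the axis, so its integrals over vertical lines vanish. Letting the line
tend to the imaginary axis and taking real parts leaves `∫ J(s) 2s / (s² + ξ²) ds = π m(ξ)`, where
`J = -Im m(is+) ≥ 0`. It lives where `tan s < 0` and equals `sin (απ) (-tan s / s)^α` there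
(`integral_tanhJump_mul`).

All size estimates reduce to `μ`. The moments `∫ s^(-β) dμ` are finite for `β > 1 - α`, which gives
`K(x) ≤ C x^(-β)` (`tanhKernel_le_rpow`). The mass of `μ` below `Nπ` is at least `c N^(1-α)`, which
gives `K(x) ≥ c x^(α-1)` near `0` (`le_tanhKernel`). Together they settle the `L^p` range. The
operator norm is `1` because `K` is a probability density; uniqueness holds because the Fourier
transform is onto the Schwartz space. -/

namespace Complex

/-! ### The function `tanh z / z` on the right half-plane -/

theorem sinh_re (z : ℂ) : (sinh z).re = Real.sinh z.re * Real.cos z.im := by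
  conv_lhs => rw [← re_add_im z, sinh_add, cosh_mul_I, sinh_mul_I]
  simp [sinh_ofReal_re, cosh_ofReal_re, sin_ofReal_re, cos_ofReal_re]

theorem sinh_im (z : ℂ) : (sinh z).im = Real.cosh z.re * Real.sin z.im := by
  conv_lhs => rw [← re_add_im z, sinh_add, cosh_mul_I, sinh_mul_I]
  simp [sinh_ofReal_re, cosh_ofReal_re, sin_ofReal_re, cos_ofReal_re]

theorem cosh_re (z : ℂ) : (cosh z).re = Real.cosh z.re * Real.cos z.im := by
  conv_lhs => rw [← re_add_im z, cosh_add, cosh_mul_I, sinh_mul_I]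
  simp [sinh_ofReal_re, cosh_ofReal_re, sin_ofReal_re, cos_ofReal_re]

theorem cosh_im (z : ℂ) : (cosh z).im = Real.sinh z.re * Real.sin z.im := by
  conv_lhs => rw [← re_add_im z, cosh_add, cosh_mul_I, sinh_mul_I]
  simp [sinh_ofReal_re, cosh_ofReal_re, sin_ofReal_re, cos_ofReal_re]

theorem normSq_sinh (z : ℂ) : normSq (sinh z) = Real.sinh z.re ^ 2 + Real.sin z.im ^ 2 := by
  rw [normSq_apply, sinh_re, sinh_im]
  linear_combination (Real.sin z.im ^ 2) * Real.cosh_sq z.re +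
    (Real.sinh z.re ^ 2) * Real.sin_sq_add_cos_sq z.im

theorem normSq_cosh (z : ℂ) : normSq (cosh z) = Real.sinh z.re ^ 2 + Real.cos z.im ^ 2 := by
  rw [normSq_apply, cosh_re, cosh_im]
  linear_combination (Real.cos z.im ^ 2) * Real.cosh_sq z.re +
    (Real.sinh z.re ^ 2) * Real.sin_sq_add_cos_sq z.im

theorem cosh_ne_zero_of_re_pos {z : ℂ} (hz : 0 < z.re) : cosh z ≠ 0 := by
  rw [← normSq_pos, normSq_cosh]
  have := Real.sinh_pos_iff.2 hz
  positivity

theorem tanh_div_self_re (z : ℂ) : (tanh z / z).re =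
    (z.re * (Real.sinh z.re * Real.cosh z.re) + z.im * (Real.sin z.im * Real.cos z.im)) *
      (normSq (cosh z * z))⁻¹ := by
  rw [tanh_eq_sinh_div_cosh, div_div, div_eq_mul_inv, inv_def, ← mul_assoc, mul_comm, re_ofReal_mul,
    mul_comm]
  congr 1
  simp only [map_mul, mul_re, mul_im, conj_re, conj_im, sinh_re, sinh_im, cosh_re, cosh_im]
  linear_combination (z.re * Real.sinh z.re * Real.cosh z.re) * Real.sin_sq_add_cos_sq z.im +
    (z.im * Real.sin z.im * Real.cos z.im) * Real.cosh_sq z.re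

theorem tanh_div_self_im (z : ℂ) : (tanh z / z).im =
    (z.re * (Real.sin z.im * Real.cos z.im) - z.im * (Real.sinh z.re * Real.cosh z.re)) *
      (normSq (cosh z * z))⁻¹ := by
  rw [tanh_eq_sinh_div_cosh, div_div, div_eq_mul_inv, inv_def, ← mul_assoc, mul_comm, im_ofReal_mul,
    mul_comm]
  congr 1
  simp only [map_mul, mul_re, mul_im, conj_re, conj_im, sinh_re, sinh_im, cosh_re, cosh_im]
  linear_combination (-z.im * Real.sinh z.re * Real.cosh z.re) * Real.sin_sq_add_cos_sq z.im +
    (z.re * Real.sin z.im * Real.cos z.im) * Real.cosh_sq z.re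

theorem lt_sinh_mul_cosh {x : ℝ} (hx : 0 < x) : x < Real.sinh x * Real.cosh x := by
  have h1 := Real.self_lt_sinh_iff.2 hx
  have h2 := Real.one_le_cosh x
  nlinarith

theorem sin_mul_cos_lt {y : ℝ} (hy : 0 < y) : Real.sin y * Real.cos y < y := by
  have h1 := Real.sin_lt (x := 2 * y) (by linarith)
  rw [Real.sin_two_mul] at h1
  linarith

theorem normSq_cosh_mul_self_pos {z : ℂ} (hz : 0 < z.re) : 0 < normSq (cosh z * z) := by
  rw [normSq_pos]
  refine mul_ne_zero (cosh_ne_zero_of_re_pos hz) ?_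
  rintro rfl
  simp at hz

/-- With `z = x + iy`, the sign is that of `x sin y cos y - y sinh x cosh x`, and `sin y cos y < y`
while `x < sinh x cosh x`. -/
theorem tanh_div_self_im_neg {z : ℂ} (hz : 0 < z.re) (hz' : 0 < z.im) :
    (tanh z / z).im < 0 := by
  rw [tanh_div_self_im]
  refine mul_neg_of_neg_of_pos ?_ (inv_pos.2 (normSq_cosh_mul_self_pos hz))
  nlinarith [lt_sinh_mul_cosh hz, sin_mul_cos_lt hz']

/-- Off the real axis the imaginary part is nonzero, by the quadrant lemma and conjugation; on it
the value is positive. This makes the principal power holomorphic. -/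
theorem tanh_div_self_mem_slitPlane {z : ℂ} (hz : 0 < z.re) : tanh z / z ∈ slitPlane := by
  rw [mem_slitPlane_iff]
  rcases lt_trichotomy z.im 0 with h | h | h
  · right
    have := tanh_div_self_im_neg (z := (starRingEnd ℂ) z) (by simpa using hz) (by simpa using h)
    rw [tanh_conj, ← map_div₀, conj_im] at this
    linarith
  · left
    rw [tanh_div_self_re, h]
    have := lt_sinh_mul_cosh hz
    have := normSq_cosh_mul_self_pos hz
    have : 0 < Real.sinh z.re * Real.cosh z.re := by linarith
    simp only [zero_mul, add_zero]
    positivity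
  · exact Or.inr (tanh_div_self_im_neg hz h).ne

theorem normSq_tanh (z : ℂ) : normSq (tanh z) =
    (Real.sinh z.re ^ 2 + Real.sin z.im ^ 2) / (Real.sinh z.re ^ 2 + Real.cos z.im ^ 2) := by
  rw [tanh_eq_sinh_div_cosh, map_div₀, normSq_sinh, normSq_cosh]

theorem norm_tanh_le_of_le_re {ε : ℝ} (hε : 0 < ε) {z : ℂ} (hz : ε ≤ z.re) :
    ‖tanh z‖ ≤ √(1 + (Real.sinh ε ^ 2)⁻¹) := by
  refine Real.le_sqrt_of_sq_le ?_
  rw [← normSq_eq_norm_sq, normSq_tanh]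
  have h1 : 0 < Real.sinh ε := Real.sinh_pos_iff.2 hε
  have h2 : Real.sinh ε ≤ Real.sinh z.re := Real.sinh_le_sinh.2 hz
  have h3 := Real.sin_sq_le_one z.im
  have h4 : Real.sinh ε ^ 2 ≤ Real.sinh z.re ^ 2 := by gcongr
  have h5 := sq_nonneg (Real.cos z.im)
  have h6 : 0 < Real.sinh ε ^ 2 := by positivity
  have h8 : 0 < Real.sinh z.re ^ 2 + Real.cos z.im ^ 2 := by linarith
  rw [div_le_iff₀ h8]
  have h7 : 1 ≤ (Real.sinh ε ^ 2)⁻¹ * (Real.sinh z.re ^ 2 + Real.cos z.im ^ 2) := by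
    rw [inv_mul_eq_div, le_div_iff₀ h6]; linarith
  linarith

/-- Unlike the bound at distance `ε`, this one is uniform up to the imaginary axis; its price is the
poles of `tanh` at the zeros of `cos`. -/
theorem norm_tanh_le_of_re_le_one {z : ℂ} (hz : |z.re| ≤ 1) (hz' : Real.cos z.im ≠ 0) :
    ‖tanh z‖ ≤ Real.cosh 1 * |Real.cos z.im|⁻¹ := by
  have hc := Real.cosh_pos 1
  refine le_of_sq_le_sq ?_ (by positivity)
  rw [← normSq_eq_norm_sq, normSq_tanh, mul_pow, inv_pow, sq_abs, Real.cosh_sq]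
  have h4 : Real.sinh z.re ^ 2 ≤ Real.sinh 1 ^ 2 := by
    rw [sq_le_sq, Real.abs_sinh, Real.abs_sinh, Real.sinh_le_sinh]
    simpa using hz
  have h6 : 0 < Real.cos z.im ^ 2 := by positivity
  have h3 := Real.sin_sq_le_one z.im
  rw [← div_eq_mul_inv]
  gcongr
  exact le_add_of_nonneg_left (sq_nonneg _)

end Complex

/-! ### The holomorphic symbol -/

/-- The holomorphic extension of the symbol to the right half-plane. -/
noncomputable def tanhSymbolC (α : ℝ) (z : ℂ) : ℂ := (Complex.tanh z / z) ^ (α : ℂ)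

theorem tanhSymbolC_ofReal (α : ℝ) {ξ : ℝ} (hξ : 0 < ξ) :
    tanhSymbolC α ξ = (tanhSymbol α ξ : ℂ) := by
  have h : 0 ≤ Real.tanh ξ / ξ := by
    rw [Real.tanh_eq_sinh_div_cosh]
    have := Real.sinh_pos_iff.2 hξ
    have := Real.cosh_pos ξ
    positivity
  rw [tanhSymbolC, tanhSymbol, if_neg hξ.ne', Complex.ofReal_cpow h]
  simp

theorem tanhSymbolC_conj (α : ℝ) {z : ℂ} (hz : 0 < z.re) :
    tanhSymbolC α ((starRingEnd ℂ) z) = (starRingEnd ℂ) (tanhSymbolC α z) := by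
  have h := Complex.cpow_conj (Complex.tanh ((starRingEnd ℂ) z) / (starRingEnd ℂ) z) α
    (Complex.slitPlane_arg_ne_pi (Complex.tanh_div_self_mem_slitPlane (by simpa using hz)))
  rw [Complex.conj_ofReal, Complex.tanh_conj, ← map_div₀, Complex.conj_conj] at h
  rw [tanhSymbolC, tanhSymbolC, Complex.tanh_conj, ← map_div₀, h]

theorem differentiableAt_tanhSymbolC (α : ℝ) {z : ℂ} (hz : 0 < z.re) :
    DifferentiableAt ℂ (tanhSymbolC α) z := by
  have hz0 : z ≠ 0 := by rintro rfl; simp at hz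
  have h1 : DifferentiableAt ℂ (fun w => Complex.tanh w / w) z := by
    simp only [Complex.tanh_eq_sinh_div_cosh]
    exact (Complex.differentiableAt_sinh.div Complex.differentiableAt_cosh
      (Complex.cosh_ne_zero_of_re_pos hz)).div differentiableAt_id hz0
  exact h1.cpow_const (Complex.tanh_div_self_mem_slitPlane hz)

theorem norm_tanhSymbolC (α : ℝ) (z : ℂ) :
    ‖tanhSymbolC α z‖ = (‖Complex.tanh z‖ / ‖z‖) ^ α := by
  rw [tanhSymbolC, Complex.norm_cpow_real, norm_div]

/-! ### Integrability of negative powers of `|cos|` -/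

theorem periodic_abs_cos_rpow (r : ℝ) :
    Function.Periodic (fun s : ℝ => |Real.cos s| ^ r) Real.pi := by
  intro s
  simp [Real.cos_add_pi]

theorem intervalIntegrable_abs_cos_rpow_neg {α : ℝ} (hα : 0 ≤ α) (hα' : α < 1) (a b : ℝ) :
    IntervalIntegrable (fun s : ℝ => |Real.cos s| ^ (-α)) volume a b := by
  refine (periodic_abs_cos_rpow (-α)).intervalIntegrable₀ Real.pi_ne_zero ?_ a b
  have h1 : ∀ a b : ℝ, IntervalIntegrable (fun x : ℝ => |x| ^ (-α)) volume a b := by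
    intro a b
    have h0 : ∀ b : ℝ, IntervalIntegrable (fun x : ℝ => |x| ^ (-α)) volume 0 b :=
      fun b => intervalIntegrable_of_even (by simp) (fun x hx =>
        (intervalIntegral.intervalIntegrable_rpow' (r := -α) (by linarith)).congr fun y hy => by
          rw [uIoc_of_le hx.le] at hy
          simp only [abs_of_pos hy.1])
    exact (h0 a).symm.trans (h0 b)
  have h2 : IntervalIntegrable (fun x : ℝ => (2 / Real.pi) ^ (-α) * |Real.pi / 2 - x| ^ (-α))
      volume 0 Real.pi := by
    have := ((h1 (Real.pi / 2) (-(Real.pi / 2))).comp_sub_left (Real.pi / 2)).const_mul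
      ((2 / Real.pi) ^ (-α))
    convert this using 1 <;> ring
  refine h2.mono_fun (Measurable.aestronglyMeasurable (by fun_prop)) ?_
  rw [uIoc_of_le Real.pi_pos.le]
  have h3 : ∀ᵐ x ∂(volume : Measure ℝ), x ≠ Real.pi / 2 := by simp [ae_iff]
  filter_upwards [ae_restrict_mem measurableSet_Ioc, ae_restrict_of_ae h3] with x hx hx'
  have h4 : 0 < |Real.pi / 2 - x| := abs_pos.2 (sub_ne_zero.2 hx'.symm)
  -- Jordan's inequality: the zero of `cos` at `π / 2` is simple, so `|π / 2 - x|^(-α)` dominates.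
  have h5 : 2 / Real.pi * |Real.pi / 2 - x| ≤ |Real.cos x| := by
    rw [← Real.sin_pi_div_two_sub]
    refine Real.mul_abs_le_abs_sin (abs_le.2 ⟨?_, ?_⟩) <;> linarith [hx.1, hx.2]
  have hp := Real.pi_pos
  rw [Real.norm_of_nonneg (by positivity), Real.norm_of_nonneg (by positivity),
    ← Real.mul_rpow (by positivity) (by positivity)]
  exact Real.rpow_le_rpow_of_nonpos (by positivity) h5 (by linarith)

/-- On the `n`th period the weight is at most `(n + 1)^(-γ)`, and `|cos|^(-α)` has the same integral
over each period. These functions dominate the contour integrals as the line approaches the axis. -/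
theorem integrableOn_abs_cos_rpow_mul {α γ : ℝ} (hα : 0 ≤ α) (hα' : α < 1) (hγ : 1 < γ) :
    IntegrableOn (fun s : ℝ => |Real.cos s| ^ (-α) * (1 + s) ^ (-γ)) (Ioi 0) := by
  have hp := Real.pi_pos
  have hU : (⋃ n : ℕ, Ioc (n * Real.pi) ((Order.succ n : ℕ) * Real.pi)) = Ioi 0 := by
    rw [iUnion_Ioc_map_succ_eq_Ioi (f := fun n : ℕ => (n : ℝ) * Real.pi)]
    · simp
    · intro a
      simp only [bot_eq_zero', CharP.cast_eq_zero, zero_mul]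
      positivity
    · rintro ⟨B, hB⟩
      obtain ⟨n, hn⟩ := exists_nat_gt (B / Real.pi)
      rw [div_lt_iff₀ hp] at hn
      exact absurd (hB ⟨n, rfl⟩) (not_le.2 hn)
  have hle : ∀ n : ℕ, (n : ℝ) * Real.pi ≤ (Order.succ n : ℕ) * Real.pi := by
    intro n
    gcongr
    exact Order.le_succ n
  have h1 : ∀ n : ℕ, IntegrableOn (fun s : ℝ => |Real.cos s| ^ (-α))
      (Ioc (n * Real.pi) ((Order.succ n : ℕ) * Real.pi)) := fun n =>
    (intervalIntegrable_iff_integrableOn_Ioc_of_le (hle n)).1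
      (intervalIntegrable_abs_cos_rpow_neg hα hα' _ _)
  have hb : ∀ n : ℕ, ∀ s ∈ Ioc (n * Real.pi) ((Order.succ n : ℕ) * Real.pi),
      ‖|Real.cos s| ^ (-α) * (1 + s) ^ (-γ)‖ ≤
        |Real.cos s| ^ (-α) * ((n + 1 : ℕ) : ℝ) ^ (-γ) := by
    intro n s hs
    have hn : (0 : ℝ) ≤ n := n.cast_nonneg
    have hs0 : (n : ℝ) ≤ s := by nlinarith [hs.1, Real.pi_gt_three]
    have hs1 : 0 ≤ s := hn.trans hs0
    rw [Real.norm_of_nonneg (by positivity)]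
    refine mul_le_mul_of_nonneg_left ?_ (by positivity)
    push_cast
    exact Real.rpow_le_rpow_of_nonpos (by positivity) (by linarith) (by linarith)
  have h2 : ∀ n : ℕ, IntegrableOn (fun s : ℝ => |Real.cos s| ^ (-α) * (1 + s) ^ (-γ))
      (Ioc (n * Real.pi) ((Order.succ n : ℕ) * Real.pi)) := by
    intro n
    refine Integrable.mono' ((h1 n).mul_const (((n + 1 : ℕ) : ℝ) ^ (-γ))) ?_ ?_
    · exact Measurable.aestronglyMeasurable (by fun_prop)
    · exact (ae_restrict_mem measurableSet_Ioc).mono (hb n)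
  rw [← hU]
  refine integrableOn_iUnion_of_summable_integral_norm h2 ?_
  have hsum : Summable fun n : ℕ =>
      (∫ s in (0 : ℝ)..0 + Real.pi, |Real.cos s| ^ (-α)) * ((n + 1 : ℕ) : ℝ) ^ (-γ) :=
    ((summable_nat_add_iff 1).2 (Real.summable_nat_rpow.2 (by linarith))).mul_left _
  refine hsum.of_nonneg_of_le (fun n => integral_nonneg fun _ => norm_nonneg _) fun n => ?_
  rw [(periodic_abs_cos_rpow (-α)).intervalIntegral_add_eq 0 (n * Real.pi),
    ← intervalIntegral.integral_mul_const, intervalIntegral.integral_of_le (by linarith)]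
  have : (n : ℝ) * Real.pi + Real.pi = (Order.succ n : ℕ) * Real.pi := by
    rw [Nat.succ_eq_succ, Nat.cast_succ]; ring
  rw [this]
  exact setIntegral_mono_on (h2 n).norm ((h1 n).mul_const _) measurableSet_Ioc (hb n)

/-! ### Integration over vertical lines -/

/-- Cauchy's theorem for a vertical line bounding a half-plane. -/
theorem integral_vertical_line_eq_zero {G : ℂ → ℂ} {ε C R δ : ℝ} (hε : 0 ≤ ε) (hC : 0 ≤ C)
    (hδ : 0 < δ) (hG : ∀ z : ℂ, ε ≤ z.re → DifferentiableAt ℂ G z)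
    (hb : ∀ z : ℂ, ε ≤ z.re → R ≤ ‖z‖ → ‖G z‖ ≤ C * ‖z‖ ^ (-(1 + δ))) :
    ∫ y : ℝ, G (ε + y * Complex.I) = 0 := by
  -- If the integrand is not integrable, the integral has the default value `0`.
  by_cases hint : Integrable fun y : ℝ => G (ε + y * Complex.I)
  swap
  · exact integral_undef hint
  have h1 := intervalIntegral_tendsto_integral hint
    (Filter.tendsto_neg_atTop_atBot.comp (tendsto_natCast_atTop_atTop (R := ℝ)))
    (tendsto_natCast_atTop_atTop (R := ℝ))
  refine tendsto_nhds_unique h1 ?_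
  have hbound : ∀ n : ℕ, 0 < n → R ≤ n → ‖∫ y in (-n : ℝ)..n, G (ε + y * Complex.I)‖ ≤
      4 * C * (n : ℝ) ^ (-δ) := by
    intro n hn hRn
    have hn' : (0 : ℝ) < n := by exact_mod_cast hn
    have hM : ∀ z : ℂ, ε ≤ z.re → n ≤ ‖z‖ → ‖G z‖ ≤ C * (n : ℝ) ^ (-(1 + δ)) := by
      intro z hz hz'
      refine (hb z hz (hRn.trans hz')).trans (mul_le_mul_of_nonneg_left ?_ hC)
      exact Real.rpow_le_rpow_of_nonpos hn' hz' (by linarith)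
    -- The other three sides have total length `4n` and lie where `‖z‖ ≥ n`, so they contribute at
    -- most `4 C n^(-δ)`.
    have hrect := Complex.integral_boundary_rect_eq_zero_of_differentiableOn G ⟨ε, -n⟩ ⟨ε + n, n⟩ (by
      intro z hz
      refine (hG z ?_).differentiableWithinAt
      have := (Complex.mem_reProdIm.1 hz).1
      rw [uIcc_of_le (by simp)] at this
      exact this.1)
    simp only [smul_eq_mul] at hrect
    have hbot : ‖∫ x in ε..ε + n, G (x + ((-n : ℝ) : ℂ) * Complex.I)‖ ≤
        C * (n : ℝ) ^ (-(1 + δ)) * |ε + n - ε| := by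
      refine intervalIntegral.norm_integral_le_of_norm_le_const fun x hx => hM _ ?_ ?_
      · rw [uIoc_of_le (by linarith)] at hx
        simpa using hx.1.le
      · refine le_trans ?_ (Complex.abs_im_le_norm _)
        simp
    have htop : ‖∫ x in ε..ε + n, G (x + ((n : ℝ) : ℂ) * Complex.I)‖ ≤
        C * (n : ℝ) ^ (-(1 + δ)) * |ε + n - ε| := by
      refine intervalIntegral.norm_integral_le_of_norm_le_const fun x hx => hM _ ?_ ?_
      · rw [uIoc_of_le (by linarith)] at hx
        simpa using hx.1.le
      · refine le_trans ?_ (Complex.abs_im_le_norm _)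
        simp
    have hright : ‖∫ y in (-n : ℝ)..n, G (((ε + n : ℝ) : ℂ) + y * Complex.I)‖ ≤
        C * (n : ℝ) ^ (-(1 + δ)) * |(n : ℝ) - -n| := by
      refine intervalIntegral.norm_integral_le_of_norm_le_const fun x _ => hM _ ?_ ?_
      · simp
      · refine le_trans ?_ (Complex.abs_re_le_norm _)
        simp only [Complex.add_re, Complex.ofReal_re, Complex.re_ofReal_mul, Complex.I_re, mul_zero,
          add_zero]
        exact le_trans (by linarith) (le_abs_self _)
    have hpow : (n : ℝ) ^ (-(1 + δ)) * n = (n : ℝ) ^ (-δ) := by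
      rw [← Real.rpow_add_one hn'.ne']
      congr 1; ring
    have hleft : ‖∫ y in (-n : ℝ)..n, G (ε + y * Complex.I)‖ ≤
        ‖∫ x in ε..ε + n, G (x + ((-n : ℝ) : ℂ) * Complex.I)‖ +
        ‖∫ x in ε..ε + n, G (x + ((n : ℝ) : ℂ) * Complex.I)‖ +
        ‖∫ y in (-n : ℝ)..n, G (((ε + n : ℝ) : ℂ) + y * Complex.I)‖ := by
      rw [sub_eq_zero] at hrect
      have := congrArg norm hrect
      rw [norm_mul, Complex.norm_I, one_mul] at this
      rw [← this]
      refine (norm_add_le _ _).trans ?_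
      rw [norm_mul, Complex.norm_I, one_mul]
      gcongr
      exact norm_sub_le _ _
    rw [add_sub_cancel_left, abs_of_pos hn'] at hbot htop
    rw [sub_neg_eq_add, abs_of_pos (by positivity)] at hright
    calc _ ≤ _ := hleft.trans (add_le_add (add_le_add hbot htop) hright)
      _ = 4 * C * ((n : ℝ) ^ (-(1 + δ)) * n) := by ring
      _ = _ := by rw [hpow]
  have hlim : Filter.Tendsto (fun n : ℕ => 4 * C * (n : ℝ) ^ (-δ)) Filter.atTop (nhds 0) := by
    simpa using ((tendsto_rpow_neg_atTop hδ).comp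
      (tendsto_natCast_atTop_atTop (R := ℝ))).const_mul (4 * C)
  refine squeeze_zero_norm' ?_ hlim
  filter_upwards [Filter.eventually_gt_atTop 0, Filter.eventually_ge_atTop ⌈R⌉₊] with n hn hn'
  exact hbound n hn ((Nat.le_ceil R).trans (by exact_mod_cast hn'))

theorem integrable_of_integrableOn_Ioi {E : Type*} [NormedAddCommGroup E] {f : ℝ → E}
    (hneg : IntegrableOn (fun y => f (-y)) (Ioi 0)) (hpos : IntegrableOn f (Ioi 0)) :
    Integrable f := by
  have h0 : IntegrableOn f (Iio 0) := by
    refine ((Measure.measurePreserving_neg (volume : Measure ℝ)).integrableOn_comp_preimage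
      (Homeomorph.neg ℝ).measurableEmbedding).1 ?_
    rwa [show (Neg.neg ⁻¹' Iio 0 : Set ℝ) = Ioi 0 by ext; simp]
  rw [← integrableOn_univ, ← Iic_union_Ioi (a := (0 : ℝ))]
  exact ((integrableOn_Iic_iff_integrableOn_Iio (f := f)).2 h0).union hpos

/-- Conjugation symmetry makes the real part even, so its half-line integral is half of the full
one. -/
theorem setIntegral_Ioi_re_eq_zero_of_conj_symm {f : ℝ → ℂ}
    (hf : ∀ y, f (-y) = (starRingEnd ℂ) (f y)) (hi : IntegrableOn f (Ioi 0))
    (h0 : ∫ y, f y = 0) : ∫ y in Ioi (0 : ℝ), (f y).re = 0 := by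
  have hint : Integrable f := by
    refine integrable_of_integrableOn_Ioi ?_ hi
    simp_rw [hf]
    exact (Complex.conjCLE : ℂ →L[ℝ] ℂ).integrable_comp hi
  have h2 : ∫ y, (f y).re = 0 := by
    have := integral_re hint
    rw [h0] at this
    exact this
  have h3 : ∀ y, (f y).re = (f |y|).re := by
    intro y
    rcases abs_cases y with h | h <;> rw [h.1]
    rw [hf, Complex.conj_re]
  rw [show (fun y => (f y).re) = fun y => (f |y|).re from funext h3,
    integral_comp_abs (f := fun y => (f y).re)] at h2
  linarith

/-! ### Boundary values on the imaginary axis -/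

section TanhKernel

variable {α ξ : ℝ}

/-- The imaginary part, up to sign, of the boundary values of `tanhSymbolC` on the positive
imaginary axis. -/
noncomputable def tanhJump (α s : ℝ) : ℝ :=
  if Real.tan s < 0 then Real.sin (α * Real.pi) * (-Real.tan s / s) ^ α else 0

/-- At `is` the base of the power is `tan s / s`. If this is negative, it is approached from the
lower half-plane, so the logarithm tends to the branch with argument `-π`; if positive, the limit is
real. -/
theorem tendsto_tanhSymbolC_boundary (α : ℝ) {s : ℝ} (hs : 0 < s) (hcos : Real.cos s ≠ 0)
    (hsin : Real.sin s ≠ 0) :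
    ∃ L : ℂ, Filter.Tendsto (fun ε : ℝ => tanhSymbolC α (ε + s * Complex.I))
      (nhdsWithin 0 (Ioi 0)) (nhds L) ∧ L.im = -tanhJump α s := by
  have hcos' : Complex.cosh (s * Complex.I) ≠ 0 := by
    rw [Complex.cosh_mul_I, ← Complex.ofReal_cos]
    exact_mod_cast hcos
  have hs' : (s : ℂ) * Complex.I ≠ 0 := by simp [hs.ne']
  have h1 : Filter.Tendsto (fun ε : ℝ => Complex.tanh (ε + s * Complex.I) / (ε + s * Complex.I))
      (nhds 0) (nhds ((Real.tan s / s : ℝ) : ℂ)) := by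
    have hv : ((Real.tan s / s : ℝ) : ℂ) =
        Complex.tanh ((0 : ℝ) + s * Complex.I) / ((0 : ℝ) + s * Complex.I) := by
      rw [Complex.ofReal_zero, zero_add, Complex.tanh_mul_I, mul_div_mul_right _ _ Complex.I_ne_zero]
      push_cast
      rfl
    rw [hv]
    have : ContinuousAt (fun ε : ℝ => Complex.tanh (ε + s * Complex.I) / (ε + s * Complex.I)) 0 := by
      simp only [Complex.tanh_eq_sinh_div_cosh]
      refine ContinuousAt.div (ContinuousAt.div ?_ ?_ (by simpa using hcos')) ?_ (by simpa using hs')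
      all_goals fun_prop
    exact this
  have h2 := h1.mono_left (nhdsWithin_le_nhds (s := Ioi 0))
  have htan : Real.tan s ≠ 0 := by
    rw [Real.tan_eq_sin_div_cos]
    exact div_ne_zero hsin hcos
  rcases htan.lt_or_gt with ht | ht
  · have hneg : Real.tan s / s < 0 := div_neg_of_neg_of_pos ht hs
    have h3 : Filter.Tendsto (fun ε : ℝ => Complex.tanh (ε + s * Complex.I) / (ε + s * Complex.I))
        (nhdsWithin 0 (Ioi 0)) (nhdsWithin ((Real.tan s / s : ℝ) : ℂ) {z | z.im < 0}) := by
      refine tendsto_nhdsWithin_iff.2 ⟨h2, ?_⟩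
      filter_upwards [self_mem_nhdsWithin] with ε hε
      exact Complex.tanh_div_self_im_neg (by simpa using hε) (by simpa using hs)
    have h4 := (Complex.tendsto_log_nhdsWithin_im_neg_of_re_neg_of_im_zero
      (z := ((Real.tan s / s : ℝ) : ℂ)) (by rwa [Complex.ofReal_re]) (Complex.ofReal_im _)).comp h3
    refine ⟨_, ((Complex.continuous_exp.tendsto _).comp (h4.mul_const (α : ℂ))).congr' ?_, ?_⟩
    · filter_upwards [self_mem_nhdsWithin] with ε hε
      have := Complex.slitPlane_ne_zero (Complex.tanh_div_self_mem_slitPlane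
        (z := (ε + s * Complex.I)) (by simpa using hε))
      rw [tanhSymbolC, Complex.cpow_def_of_ne_zero this]
      rfl
    · rw [Complex.norm_real, Real.norm_of_nonpos hneg.le, ← neg_div, tanhJump, if_pos ht]
      have hpos : 0 < -Real.tan s / s := div_pos (neg_pos.2 ht) hs
      rw [Complex.exp_im, Real.rpow_def_of_pos hpos]
      simp [Real.sin_neg, mul_comm]
  · have hpos : 0 < Real.tan s / s := div_pos ht hs
    refine ⟨_, h2.cpow tendsto_const_nhds (Or.inl (by rwa [Complex.ofReal_re])), ?_⟩
    rw [← Complex.ofReal_cpow hpos.le, Complex.ofReal_im, tanhJump, if_neg ht.not_gt, neg_zero]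

/-! ### Bounds for the contour integrand -/

/-- The integrand of the contour integral. -/
noncomputable def cauchyKernel (α ξ : ℝ) (z : ℂ) : ℂ :=
  dslope (fun w => 2 * w * tanhSymbolC α w) ξ z / (z + ξ)

theorem cauchyKernel_of_ne (α : ℝ) {ξ : ℝ} (hξ : 0 < ξ) {z : ℂ} (hz : z ≠ ξ) : cauchyKernel α ξ z =
    (2 * z * tanhSymbolC α z - (2 * ξ * tanhSymbol α ξ : ℝ)) / (z ^ 2 - ξ ^ 2) := by
  rw [cauchyKernel, dslope_of_ne _ hz, slope_def_field, div_div, tanhSymbolC_ofReal α hξ]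
  push_cast
  congr 1
  ring

theorem differentiableAt_cauchyKernel (α : ℝ) (hξ : 0 < ξ) {z : ℂ} (hz : 0 < z.re) :
    DifferentiableAt ℂ (cauchyKernel α ξ) z := by
  have hopen : IsOpen {z : ℂ | 0 < z.re} := isOpen_lt continuous_const Complex.continuous_re
  have h1 : DifferentiableOn ℂ (fun w => 2 * w * tanhSymbolC α w) {z : ℂ | 0 < z.re} :=
    fun w hw => ((by fun_prop : DifferentiableAt ℂ (fun w => 2 * w) w).mul
      (differentiableAt_tanhSymbolC α hw)).differentiableWithinAt
  have h2 := (Complex.differentiableOn_dslope (c := (ξ : ℂ))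
    (hopen.mem_nhds (by simpa using hξ))).2 h1
  refine (h2.differentiableAt (hopen.mem_nhds hz)).div (by fun_prop) ?_
  intro h
  have := congrArg Complex.re h
  simp at this
  linarith

theorem norm_two_mul_tanhSymbolC (α : ℝ) {z : ℂ} (hz : z ≠ 0) :
    ‖2 * z * tanhSymbolC α z‖ = 2 * ‖Complex.tanh z‖ ^ α * ‖z‖ ^ (1 - α) := by
  rw [norm_mul, norm_mul, norm_tanhSymbolC, Real.div_rpow (norm_nonneg _) (norm_nonneg _),
    Real.rpow_sub (norm_pos_iff.2 hz), Real.rpow_one, Complex.norm_ofNat]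
  ring

theorem norm_cauchyKernel_le_of_le_re (hα : 0 < α) (hα' : α < 1) (hξ : 0 < ξ) {ε : ℝ}
    (hε : 0 < ε) : ∃ C : ℝ, 0 ≤ C ∧ ∀ z : ℂ, ε ≤ z.re → max 1 (2 * ξ) ≤ ‖z‖ →
      ‖cauchyKernel α ξ z‖ ≤ C * ‖z‖ ^ (-(1 + α)) := by
  set B := √(1 + (Real.sinh ε ^ 2)⁻¹) with hB
  set M := ‖((2 * ξ * tanhSymbol α ξ : ℝ) : ℂ)‖ with hM
  refine ⟨(2 * B ^ α + M) * (4 / 3), by positivity, fun z hz hz' => ?_⟩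
  have hz1 : 1 ≤ ‖z‖ := (le_max_left _ _).trans hz'
  have hz2 : 2 * ξ ≤ ‖z‖ := (le_max_right _ _).trans hz'
  have hz0 : 0 < ‖z‖ := by linarith
  have hzξ : z ≠ ξ := by
    rintro rfl
    rw [Complex.norm_real, Real.norm_of_nonneg hξ.le] at hz2
    linarith
  rw [cauchyKernel_of_ne α hξ hzξ, norm_div]
  have h1 : ‖2 * z * tanhSymbolC α z - (2 * ξ * tanhSymbol α ξ : ℝ)‖ ≤
      (2 * B ^ α + M) * ‖z‖ ^ (1 - α) := by
    refine (norm_sub_le _ _).trans ?_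
    rw [norm_two_mul_tanhSymbolC α (norm_pos_iff.1 hz0), add_mul]
    have hone : 1 ≤ ‖z‖ ^ (1 - α) := Real.one_le_rpow hz1 (by linarith)
    have := Complex.norm_tanh_le_of_le_re hε hz
    gcongr
    exact le_mul_of_one_le_right (norm_nonneg _) hone
  -- From `‖z‖ ≥ 2ξ`, that is, `ξ² ≤ ‖z‖² / 4`.
  have h2 : 3 / 4 * ‖z‖ ^ 2 ≤ ‖z ^ 2 - ξ ^ 2‖ := by
    have := norm_sub_norm_le (z ^ 2) ((ξ : ℂ) ^ 2)
    rw [norm_pow, norm_pow, Complex.norm_real, Real.norm_of_nonneg hξ.le] at this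
    nlinarith
  calc _ ≤ (2 * B ^ α + M) * ‖z‖ ^ (1 - α) / (3 / 4 * ‖z‖ ^ 2) := by gcongr
    _ = (2 * B ^ α + M) * (4 / 3) * (‖z‖ ^ (1 - α) / ‖z‖ ^ (2 : ℝ)) := by
      rw [Real.rpow_two]; field_simp
    _ = _ := by rw [← Real.rpow_sub hz0]; congr 2; ring

/-- The bound does not depend on `ε`, as dominated convergence for `ε → 0` requires. -/
theorem norm_cauchyKernel_le_abs_cos (hα : 0 < α) (hα' : α < 1) (hξ : 0 < ξ) :
    ∃ C : ℝ, ∀ ε s : ℝ, 0 < ε → ε ≤ min 1 (ξ / 2) → 0 < s → Real.cos s ≠ 0 →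
      ‖cauchyKernel α ξ (ε + s * Complex.I)‖ ≤
        C * (|Real.cos s| ^ (-α) * (1 + s) ^ (-(1 + α))) := by
  set M := ‖((2 * ξ * tanhSymbol α ξ : ℝ) : ℂ)‖ with hM
  -- Both `z - ξ` and `z + ξ` have real part at least `ξ / 2` and imaginary part `s` in absolute
  -- value, so their norms are at least the average `ξ / 4 + s / 2 ≥ c (1 + s)`.
  set c := min (ξ / 2) 1 / 2 with hc
  have hc0 : 0 < c := by positivity
  refine ⟨(2 * Real.cosh 1 ^ α + M) / c ^ 2, fun ε s hε hε' hs hcos => ?_⟩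
  set z : ℂ := ε + s * Complex.I with hz
  have hre : z.re = ε := by simp [hz]
  have him : z.im = s := by simp [hz]
  have hzξ : z ≠ ξ := by
    intro h
    have := congrArg Complex.im h
    rw [him, Complex.ofReal_im] at this
    exact hs.ne' this
  have hz0 : z ≠ 0 := by
    intro h
    rw [h] at hre
    exact hε.ne hre
  have hε1 : ε ≤ 1 := hε'.trans (min_le_left _ _)
  have hε2 : ε ≤ ξ / 2 := hε'.trans (min_le_right _ _)
  have hzn : ‖z‖ ≤ 1 + s := by
    have := Complex.norm_le_abs_re_add_abs_im z
    rw [hre, him, abs_of_pos hε, abs_of_pos hs] at this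
    linarith
  have hcp : 0 < |Real.cos s| := abs_pos.2 hcos
  have h1c : 1 ≤ |Real.cos s| ^ (-α) :=
    Real.one_le_rpow_of_pos_of_le_one_of_nonpos hcp (Real.abs_cos_le_one s) (by linarith)
  have h1s : 1 ≤ (1 + s) ^ (1 - α) := Real.one_le_rpow (by linarith) (by linarith)
  rw [cauchyKernel_of_ne α hξ hzξ, norm_div]
  have h1 : ‖2 * z * tanhSymbolC α z - (2 * ξ * tanhSymbol α ξ : ℝ)‖ ≤
      (2 * Real.cosh 1 ^ α + M) * (|Real.cos s| ^ (-α) * (1 + s) ^ (1 - α)) := by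
    refine (norm_sub_le _ _).trans ?_
    rw [norm_two_mul_tanhSymbolC α hz0, add_mul]
    have ht := Complex.norm_tanh_le_of_re_le_one (z := z) (by rw [hre, abs_of_pos hε]; exact hε1)
      (by rwa [him])
    rw [him] at ht
    have ht' : ‖Complex.tanh z‖ ^ α ≤ Real.cosh 1 ^ α * |Real.cos s| ^ (-α) := by
      rw [Real.rpow_neg hcp.le, ← Real.inv_rpow hcp.le,
        ← Real.mul_rpow (Real.cosh_pos 1).le (by positivity)]
      gcongr
    refine add_le_add ?_ (le_mul_of_one_le_right (norm_nonneg _) (by nlinarith))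
    have h1z : ‖z‖ ^ (1 - α) ≤ (1 + s) ^ (1 - α) :=
      Real.rpow_le_rpow (norm_nonneg _) hzn (by linarith)
    have := Real.cosh_pos 1
    calc _ ≤ 2 * (Real.cosh 1 ^ α * |Real.cos s| ^ (-α)) * (1 + s) ^ (1 - α) := by gcongr
      _ = _ := by ring
  have h2 : c ^ 2 * (1 + s) ^ (2 : ℝ) ≤ ‖z ^ 2 - ξ ^ 2‖ := by
    have e : z ^ 2 - ξ ^ 2 = (z - ξ) * (z + ξ) := by ring
    have hm1 : min (ξ / 2) 1 ≤ ξ / 2 := min_le_left _ _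
    have hm2 : min (ξ / 2) 1 ≤ 1 := min_le_right _ _
    have hcs : c * (1 + s) ≤ ξ / 4 + s / 2 := by rw [hc]; nlinarith
    have e1 : c * (1 + s) ≤ ‖z - ξ‖ := by
      have a1 := Complex.abs_re_le_norm (z - ξ)
      have a2 := Complex.abs_im_le_norm (z - ξ)
      rw [Complex.sub_re, hre, Complex.ofReal_re, abs_of_neg (by linarith)] at a1
      rw [Complex.sub_im, him, Complex.ofReal_im, sub_zero, abs_of_pos hs] at a2
      linarith
    have e2 : c * (1 + s) ≤ ‖z + ξ‖ := by
      have a1 := Complex.abs_re_le_norm (z + ξ)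
      have a2 := Complex.abs_im_le_norm (z + ξ)
      rw [Complex.add_re, hre, Complex.ofReal_re, abs_of_pos (by linarith)] at a1
      rw [Complex.add_im, him, Complex.ofReal_im, add_zero, abs_of_pos hs] at a2
      linarith
    rw [e, norm_mul, Real.rpow_two, ← mul_pow, sq]
    gcongr
  have hs1 : 0 < 1 + s := by linarith
  calc _ ≤ (2 * Real.cosh 1 ^ α + M) * (|Real.cos s| ^ (-α) * (1 + s) ^ (1 - α)) /
        (c ^ 2 * (1 + s) ^ (2 : ℝ)) := by gcongr
    _ = (2 * Real.cosh 1 ^ α + M) / c ^ 2 *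
        (|Real.cos s| ^ (-α) * ((1 + s) ^ (1 - α) / (1 + s) ^ (2 : ℝ))) := by
      field_simp
    _ = _ := by rw [← Real.rpow_sub hs1]; congr 3; ring

/-! ### Size of the jump -/

theorem pi_div_two_lt_of_tan_neg {s : ℝ} (hs : 0 < s) (ht : Real.tan s < 0) : Real.pi / 2 < s := by
  by_contra! h
  exact ht.not_ge (Real.tan_nonneg_of_nonneg_of_le_pi_div_two hs.le h)

theorem measurable_tanhJump (α : ℝ) : Measurable (tanhJump α) := by
  have h : Measurable Real.tan := by
    rw [show Real.tan = fun x => Real.sin x / Real.cos x from funext Real.tan_eq_sin_div_cos]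
    fun_prop
  exact Measurable.ite (measurableSet_lt h measurable_const) (by fun_prop) measurable_const

theorem sin_mul_pi_pos (hα : α ∈ Ioo (0 : ℝ) 1) : 0 < Real.sin (α * Real.pi) := by
  have hp := Real.pi_pos
  exact Real.sin_pos_of_pos_of_lt_pi (mul_pos hα.1 hp) (by nlinarith [hα.2])

theorem tanhJump_nonneg (hα : α ∈ Ioo (0 : ℝ) 1) {s : ℝ} (hs : 0 < s) : 0 ≤ tanhJump α s := by
  rw [tanhJump]
  split_ifs with h
  · have h1 : 0 < -Real.tan s / s := div_pos (neg_pos.2 h) hs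
    have := sin_mul_pi_pos hα
    positivity
  · exact le_rfl

/-- The jump vanishes for `s ≤ π / 2`, so `s^(-β)` causes no singularity at `0` and powers of `s`
may be traded for powers of `1 + s`. -/
theorem tanhJump_mul_rpow_le (hα : α ∈ Ioo (0 : ℝ) 1) {s β : ℝ} (hs : 0 < s) (hβ : 0 ≤ β) :
    tanhJump α s * s ^ (-β) ≤ 2 ^ (α + β) * (|Real.cos s| ^ (-α) * (1 + s) ^ (-(α + β))) := by
  by_cases h : Real.tan s < 0
  swap
  · rw [tanhJump, if_neg h, zero_mul]
    positivity
  have h1 : 1 < s := by linarith [pi_div_two_lt_of_tan_neg hs h, Real.pi_gt_three]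
  have hc : 0 < |Real.cos s| := by
    refine abs_pos.2 fun hc => ?_
    rw [Real.tan_eq_sin_div_cos, hc, div_zero] at h
    exact h.false
  have h2 : -Real.tan s ≤ |Real.cos s|⁻¹ := by
    refine (neg_le_abs _).trans ?_
    rw [Real.tan_eq_sin_div_cos, abs_div, div_eq_mul_inv]
    exact mul_le_of_le_one_left (by positivity) (Real.abs_sin_le_one s)
  have h3 : (-Real.tan s / s) ^ α ≤ |Real.cos s| ^ (-α) * s ^ (-α) := by
    rw [Real.rpow_neg hc.le, ← Real.inv_rpow hc.le, Real.rpow_neg hs.le, ← Real.inv_rpow hs.le,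
      ← Real.mul_rpow (by positivity) (by positivity), div_eq_mul_inv]
    have : 0 ≤ -Real.tan s := by linarith
    have := hα.1
    gcongr
  have h4 : s ^ (-(α + β)) ≤ 2 ^ (α + β) * (1 + s) ^ (-(α + β)) := by
    have e : (2 : ℝ) ^ (α + β) = (1 / 2 : ℝ) ^ (-(α + β)) := by
      rw [one_div, Real.inv_rpow (by norm_num), Real.rpow_neg (by norm_num), inv_inv]
    rw [e, ← Real.mul_rpow (by norm_num) (by linarith)]
    exact Real.rpow_le_rpow_of_nonpos (by linarith) (by linarith) (by linarith [hα.1])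
  rw [tanhJump, if_pos h]
  have h5 : 0 ≤ (-Real.tan s / s) ^ α := Real.rpow_nonneg (div_nonneg (by linarith) hs.le) _
  calc _ ≤ 1 * (-Real.tan s / s) ^ α * s ^ (-β) := by
        gcongr
        exact Real.sin_le_one _
    _ ≤ 1 * (|Real.cos s| ^ (-α) * s ^ (-α)) * s ^ (-β) := by gcongr
    _ = |Real.cos s| ^ (-α) * s ^ (-(α + β)) := by
      rw [neg_add, Real.rpow_add hs]; ring
    _ ≤ |Real.cos s| ^ (-α) * (2 ^ (α + β) * (1 + s) ^ (-(α + β))) := by gcongr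
    _ = _ := by ring

theorem integrableOn_tanhJump_mul_rpow (hα : α ∈ Ioo (0 : ℝ) 1) {β : ℝ} (hβ : 1 - α < β) :
    IntegrableOn (fun s => tanhJump α s * s ^ (-β)) (Ioi 0) := by
  have hβ0 : 0 ≤ β := by linarith [hα.2]
  refine Integrable.mono' ((integrableOn_abs_cos_rpow_mul hα.1.le hα.2
    (γ := α + β) (by linarith)).const_mul (2 ^ (α + β))) ?_ ?_
  · exact ((measurable_tanhJump α).mul (by fun_prop)).aestronglyMeasurable
  · filter_upwards [ae_restrict_mem measurableSet_Ioi] with s hs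
    have hs : 0 < s := hs
    rw [Real.norm_of_nonneg (mul_nonneg (tanhJump_nonneg hα hs) (by positivity))]
    exact tanhJump_mul_rpow_le hα hs hβ0

theorem ae_cos_ne_zero : ∀ᵐ s : ℝ, Real.cos s ≠ 0 := by
  refine Set.Countable.ae_notMem (s := {s | Real.cos s = 0}) ?_ volume
  have : {s : ℝ | Real.cos s = 0} = range fun k : ℤ => (2 * (k : ℝ) + 1) * Real.pi / 2 := by
    ext s
    exact Real.cos_eq_zero_iff.trans (exists_congr fun k => eq_comm)
  rw [this]
  exact countable_range _

theorem ae_sin_ne_zero : ∀ᵐ s : ℝ, Real.sin s ≠ 0 := by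
  refine Set.Countable.ae_notMem (s := {s | Real.sin s = 0}) ?_ volume
  have : {s : ℝ | Real.sin s = 0} = range fun k : ℤ => (k : ℝ) * Real.pi := by
    ext s
    simp [Real.sin_eq_zero_iff]
  rw [this]
  exact countable_range _

/-! ### The Stieltjes representation -/

theorem integral_Ioi_inv_sq_add_sq (hξ : 0 < ξ) :
    ∫ s in Ioi (0 : ℝ), (s ^ 2 + ξ ^ 2)⁻¹ = Real.pi / (2 * ξ) := by
  have h := integral_comp_mul_left_Ioi (fun x : ℝ => (1 + x ^ 2)⁻¹) 0 (inv_pos.2 hξ)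
  rw [mul_zero, integral_Ioi_inv_one_add_sq, Real.arctan_zero, inv_inv, smul_eq_mul] at h
  have e : ∀ s : ℝ, (s ^ 2 + ξ ^ 2)⁻¹ = (ξ ^ 2)⁻¹ * (1 + (ξ⁻¹ * s) ^ 2)⁻¹ := by
    intro s
    rw [← mul_inv]
    congr 1
    field_simp
    ring
  simp_rw [e]
  rw [integral_const_mul, h]
  field_simp
  ring

theorem integrableOn_Ioi_inv_sq_add_sq (hξ : 0 < ξ) :
    IntegrableOn (fun s : ℝ => (s ^ 2 + ξ ^ 2)⁻¹) (Ioi 0) := by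
  -- A nonzero integral is not the default value, so the function is integrable.
  refine not_imp_comm.1 integral_undef ?_
  rw [integral_Ioi_inv_sq_add_sq hξ]
  have := Real.pi_pos
  positivity

theorem setIntegral_re_cauchyKernel_eq_zero (hα : α ∈ Ioo (0 : ℝ) 1) (hξ : 0 < ξ) {ε : ℝ}
    (hε : 0 < ε) (hε' : ε ≤ min 1 (ξ / 2)) :
    ∫ s in Ioi (0 : ℝ), (cauchyKernel α ξ (ε + s * Complex.I)).re = 0 := by
  have hcont : Continuous fun s : ℝ => cauchyKernel α ξ (ε + s * Complex.I) := by
    rw [continuous_iff_continuousAt]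
    intro s
    exact ContinuousAt.comp (f := fun s : ℝ => (ε + s * Complex.I : ℂ)) (g := cauchyKernel α ξ)
      (differentiableAt_cauchyKernel α hξ (by simpa using hε)).continuousAt (by fun_prop)
  refine setIntegral_Ioi_re_eq_zero_of_conj_symm
    (f := fun s : ℝ => cauchyKernel α ξ (ε + s * Complex.I)) (fun s => ?_) ?_ ?_
  · have hne : (ε : ℂ) + s * Complex.I ≠ ξ := by
      intro h
      have := congrArg Complex.re h
      simp at this
      have := hε'.trans (min_le_right _ _)
      linarith
    have e : (ε : ℂ) + ((-s : ℝ) : ℂ) * Complex.I = (starRingEnd ℂ) (ε + s * Complex.I) := by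
      simp
    have hne' : (starRingEnd ℂ) ((ε : ℂ) + s * Complex.I) ≠ ξ := by
      intro h
      apply hne
      rw [← Complex.conj_conj ((ε : ℂ) + s * Complex.I), h, Complex.conj_ofReal]
    simp only [e]
    rw [cauchyKernel_of_ne α hξ hne, cauchyKernel_of_ne α hξ hne',
      tanhSymbolC_conj α (by simpa using hε)]
    simp only [map_div₀, map_sub, map_mul, map_pow, Complex.conj_ofReal, map_ofNat]
  · obtain ⟨C, hC⟩ := norm_cauchyKernel_le_abs_cos hα.1 hα.2 hξ
    refine Integrable.mono' ((integrableOn_abs_cos_rpow_mul hα.1.le hα.2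
      (γ := 1 + α) (by linarith [hα.1])).const_mul C) hcont.aestronglyMeasurable ?_
    filter_upwards [ae_restrict_mem measurableSet_Ioi, ae_restrict_of_ae ae_cos_ne_zero] with s hs hs'
    exact hC ε s hε hε' hs hs'
  · obtain ⟨C, hC, hb⟩ := norm_cauchyKernel_le_of_le_re hα.1 hα.2 hξ hε
    exact integral_vertical_line_eq_zero hε.le hC hα.1
      (fun z hz => differentiableAt_cauchyKernel α hξ (hε.trans_le hz)) hb

/-- The Stieltjes representation of the symbol `(tanh ξ / ξ) ^ α`. -/
theorem integral_tanhJump_mul (hα : α ∈ Ioo (0 : ℝ) 1) (hξ : 0 < ξ) :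
    ∫ s in Ioi (0 : ℝ), tanhJump α s * (2 * s / (s ^ 2 + ξ ^ 2)) = Real.pi * tanhSymbol α ξ := by
  obtain ⟨C, hC⟩ := norm_cauchyKernel_le_abs_cos hα.1 hα.2 hξ
  have hev : ∀ᶠ ε : ℝ in nhdsWithin 0 (Ioi 0), 0 < ε ∧ ε ≤ min 1 (ξ / 2) := by
    filter_upwards [Ioc_mem_nhdsGT (show (0 : ℝ) < min 1 (ξ / 2) by positivity)] with ε hε
    exact hε
  have hlim := tendsto_integral_filter_of_dominated_convergence
    (μ := volume.restrict (Ioi (0 : ℝ))) (l := nhdsWithin (0 : ℝ) (Ioi 0))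
    (F := fun ε s => (cauchyKernel α ξ (ε + s * Complex.I)).re)
    (f := fun s => (2 * ξ * tanhSymbol α ξ - 2 * s * tanhJump α s) / (s ^ 2 + ξ ^ 2))
    (fun s => C * (|Real.cos s| ^ (-α) * (1 + s) ^ (-(1 + α)))) ?_ ?_ ?_ ?_
  · have h0 : ∫ s in Ioi (0 : ℝ),
        (2 * ξ * tanhSymbol α ξ - 2 * s * tanhJump α s) / (s ^ 2 + ξ ^ 2) = 0 := by
      -- The integrals are zero for every small `ε`, hence so is their limit.
      refine tendsto_nhds_unique hlim (tendsto_const_nhds.congr' ?_)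
      filter_upwards [hev] with ε hε
      exact (setIntegral_re_cauchyKernel_eq_zero hα hξ hε.1 hε.2).symm
    have hi : IntegrableOn (fun s => tanhJump α s * (2 * s / (s ^ 2 + ξ ^ 2))) (Ioi 0) := by
      refine Integrable.mono' ((integrableOn_tanhJump_mul_rpow hα
        (β := 1) (by linarith [hα.1])).const_mul 2) ?_ ?_
      · exact ((measurable_tanhJump α).mul (by fun_prop)).aestronglyMeasurable
      · filter_upwards [ae_restrict_mem measurableSet_Ioi] with s hs
        have hs : 0 < s := hs
        have := tanhJump_nonneg hα hs
        rw [Real.norm_of_nonneg (by positivity), Real.rpow_neg_one, mul_left_comm]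
        refine mul_le_mul_of_nonneg_left ?_ this
        rw [div_le_iff₀ (by positivity)]
        field_simp
        nlinarith [sq_nonneg ξ]
    have hsplit : ∀ s : ℝ, (2 * ξ * tanhSymbol α ξ - 2 * s * tanhJump α s) / (s ^ 2 + ξ ^ 2) =
        2 * ξ * tanhSymbol α ξ * (s ^ 2 + ξ ^ 2)⁻¹ - tanhJump α s * (2 * s / (s ^ 2 + ξ ^ 2)) := by
      intro s; ring
    simp_rw [hsplit] at h0
    rw [integral_sub ((integrableOn_Ioi_inv_sq_add_sq hξ).const_mul _) hi, integral_const_mul,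
      integral_Ioi_inv_sq_add_sq hξ] at h0
    rw [← sub_eq_zero.1 h0]
    field_simp
  · filter_upwards [hev] with ε hε
    have hcont : Continuous fun s : ℝ => cauchyKernel α ξ (ε + s * Complex.I) := by
      rw [continuous_iff_continuousAt]
      intro s
      exact ContinuousAt.comp (f := fun s : ℝ => (ε + s * Complex.I : ℂ)) (g := cauchyKernel α ξ)
        (differentiableAt_cauchyKernel α hξ (by simpa using hε.1)).continuousAt (by fun_prop)
    exact (Complex.continuous_re.comp hcont).aestronglyMeasurable
  · filter_upwards [hev] with ε hε
    filter_upwards [ae_restrict_mem measurableSet_Ioi, ae_restrict_of_ae ae_cos_ne_zero] with s hs hs'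
    exact (Complex.abs_re_le_norm _).trans (hC ε s hε.1 hε.2 hs hs')
  · exact (integrableOn_abs_cos_rpow_mul hα.1.le hα.2
      (γ := 1 + α) (by linarith [hα.1])).const_mul C
  · filter_upwards [ae_restrict_mem measurableSet_Ioi, ae_restrict_of_ae ae_cos_ne_zero,
      ae_restrict_of_ae ae_sin_ne_zero] with s hs hcos hsin
    have hs : 0 < s := hs
    obtain ⟨L, hL, hLim⟩ := tendsto_tanhSymbolC_boundary α hs hcos hsin
    have hz : Filter.Tendsto (fun ε : ℝ => (ε + s * Complex.I : ℂ)) (nhdsWithin 0 (Ioi 0))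
        (nhds (s * Complex.I)) := by
      have : ContinuousAt (fun ε : ℝ => (ε + s * Complex.I : ℂ)) 0 := by fun_prop
      have := this.tendsto.mono_left (nhdsWithin_le_nhds (s := Ioi 0))
      simpa using this
    have hden : ((s : ℂ) * Complex.I) ^ 2 - (ξ : ℂ) ^ 2 = ((-(s ^ 2 + ξ ^ 2) : ℝ) : ℂ) := by
      rw [mul_pow, Complex.I_sq]; push_cast; ring
    have h1 := (((hz.const_mul 2).mul hL).sub_const ((2 * ξ * tanhSymbol α ξ : ℝ) : ℂ)).div
      ((hz.pow 2).sub_const ((ξ : ℂ) ^ 2)) (by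
        rw [hden, Complex.ofReal_ne_zero]
        have : 0 < s ^ 2 + ξ ^ 2 := by positivity
        linarith)
    have h2 := (Complex.continuous_re.tendsto _).comp h1
    have e : ((2 * (s * Complex.I) * L - ((2 * ξ * tanhSymbol α ξ : ℝ) : ℂ)) /
        ((s * Complex.I) ^ 2 - (ξ : ℂ) ^ 2)).re =
        (2 * ξ * tanhSymbol α ξ - 2 * s * tanhJump α s) / (s ^ 2 + ξ ^ 2) := by
      rw [hden, Complex.div_ofReal_re, Complex.sub_re, Complex.ofReal_re]
      -- The factor `i` turns the imaginary part of the boundary value, which is known, into a real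
      -- part.
      have : (2 * (s * Complex.I) * L).re = 2 * s * tanhJump α s := by
        simp [Complex.mul_re, Complex.mul_im, hLim]
      rw [this, div_neg, ← neg_div]
      congr 1
      ring
    rw [e] at h2
    refine h2.congr' ?_
    filter_upwards [self_mem_nhdsWithin] with ε hε
    rw [cauchyKernel_of_ne α hξ]
    · rfl
    · intro h
      have := congrArg Complex.im h
      simp at this
      exact hs.ne' this

/-! ### The representing measure -/

/-- The measure on the positive half-line whose Laplace transform, evaluated at `|x|`, is the
kernel with symbol `(tanh ξ / ξ) ^ α`. -/
noncomputable def tanhMeasure (α : ℝ) : Measure ℝ :=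
  (volume.restrict (Ioi 0)).withDensity fun s => ENNReal.ofReal (tanhJump α s / Real.pi)

instance : SFinite (tanhMeasure α) := by
  unfold tanhMeasure
  infer_instance

theorem measurable_ofReal_tanhJump (α : ℝ) :
    Measurable fun s => ENNReal.ofReal (tanhJump α s / Real.pi) :=
  ((measurable_tanhJump α).div_const _).ennreal_ofReal

theorem toReal_ofReal_tanhJump (hα : α ∈ Ioo (0 : ℝ) 1) {s : ℝ} (hs : 0 < s) :
    (ENNReal.ofReal (tanhJump α s / Real.pi)).toReal = tanhJump α s / Real.pi :=
  ENNReal.toReal_ofReal (div_nonneg (tanhJump_nonneg hα hs) Real.pi_pos.le)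

theorem ae_tanhMeasure_pi_div_two_lt (α : ℝ) : ∀ᵐ s ∂tanhMeasure α, Real.pi / 2 < s := by
  rw [tanhMeasure, ae_withDensity_iff (measurable_ofReal_tanhJump α)]
  filter_upwards [ae_restrict_mem measurableSet_Ioi] with s hs h
  refine pi_div_two_lt_of_tan_neg hs ?_
  by_contra ht
  rw [tanhJump, if_neg ht] at h
  simp at h

theorem ae_tanhMeasure_pos (α : ℝ) : ∀ᵐ s ∂tanhMeasure α, 0 < s := by
  filter_upwards [ae_tanhMeasure_pi_div_two_lt α] with s hs
  linarith [Real.pi_pos]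

theorem integrable_tanhMeasure_rpow (hα : α ∈ Ioo (0 : ℝ) 1) {β : ℝ} (hβ : 1 - α < β) :
    Integrable (fun s : ℝ => s ^ (-β)) (tanhMeasure α) := by
  rw [tanhMeasure, integrable_withDensity_iff_integrable_smul' (measurable_ofReal_tanhJump α)
    (by simp)]
  refine ((integrableOn_tanhJump_mul_rpow hα hβ).const_mul (Real.pi⁻¹)).congr ?_
  filter_upwards [ae_restrict_mem measurableSet_Ioi] with s hs
  rw [toReal_ofReal_tanhJump hα hs, smul_eq_mul]
  ring

theorem tanhSymbol_neg (α ξ : ℝ) : tanhSymbol α (-ξ) = tanhSymbol α ξ := by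
  simp [tanhSymbol, Real.tanh_neg, neg_div_neg_eq]

theorem integral_tanhMeasure_of_pos (hα : α ∈ Ioo (0 : ℝ) 1) {ξ : ℝ} (hξ : 0 < ξ) :
    ∫ s, 2 * s / (s ^ 2 + ξ ^ 2) ∂tanhMeasure α = tanhSymbol α ξ := by
  rw [tanhMeasure, integral_withDensity_eq_integral_toReal_smul (measurable_ofReal_tanhJump α)
    (by simp)]
  have h : ∫ s in Ioi (0 : ℝ), (ENNReal.ofReal (tanhJump α s / Real.pi)).toReal •
      (2 * s / (s ^ 2 + ξ ^ 2)) =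
      ∫ s in Ioi (0 : ℝ), Real.pi⁻¹ * (tanhJump α s * (2 * s / (s ^ 2 + ξ ^ 2))) := by
    refine setIntegral_congr_fun measurableSet_Ioi fun s hs => ?_
    rw [toReal_ofReal_tanhJump hα hs, smul_eq_mul]
    ring
  rw [h, integral_const_mul, integral_tanhJump_mul hα hξ, inv_mul_cancel_left₀ Real.pi_ne_zero]

theorem tendsto_tanhSymbol (α : ℝ) :
    Filter.Tendsto (tanhSymbol α) (nhdsWithin 0 (Ioi 0)) (nhds 1) := by
  have h1 : HasDerivAt Real.tanh 1 0 := by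
    rw [show Real.tanh = Real.sinh / Real.cosh from funext Real.tanh_eq_sinh_div_cosh]
    have := (Real.hasDerivAt_sinh 0).div (Real.hasDerivAt_cosh 0) (Real.cosh_pos 0).ne'
    simpa using this
  have h2 := hasDerivAt_iff_tendsto_slope.1 h1
  have h3 := (h2.mono_left (nhdsWithin_mono 0 (fun x (hx : 0 < x) => hx.ne'))).rpow_const
    (p := α) (Or.inl one_ne_zero)
  rw [Real.one_rpow] at h3
  refine h3.congr' ?_
  filter_upwards [self_mem_nhdsWithin] with x hx
  have hx : x ≠ 0 := (show 0 < x from hx).ne'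
  simp [tanhSymbol, hx, slope_def_field]

theorem integrable_tanhMeasure_inv (hα : α ∈ Ioo (0 : ℝ) 1) :
    Integrable (fun s : ℝ => s⁻¹) (tanhMeasure α) := by
  simpa [Real.rpow_neg_one] using integrable_tanhMeasure_rpow hα (β := 1) (by linarith [hα.1])

theorem integral_tanhMeasure (hα : α ∈ Ioo (0 : ℝ) 1) (ξ : ℝ) :
    ∫ s, 2 * s / (s ^ 2 + ξ ^ 2) ∂tanhMeasure α = tanhSymbol α ξ := by
  rcases lt_trichotomy ξ 0 with h | rfl | h
  · rw [← tanhSymbol_neg, ← neg_sq ξ]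
    exact integral_tanhMeasure_of_pos hα (neg_pos.2 h)
  -- The contour argument needs `ξ > 0`; the value at `0` is recovered as a limit, dominated by `2 /
  -- s`.
  · have h1 : Filter.Tendsto (fun ξ : ℝ => ∫ s, 2 * s / (s ^ 2 + ξ ^ 2) ∂tanhMeasure α)
        (nhdsWithin 0 (Ioi 0)) (nhds (∫ s, 2 * s / (s ^ 2 + 0 ^ 2) ∂tanhMeasure α)) := by
      refine tendsto_integral_filter_of_dominated_convergence (fun s => 2 * s⁻¹) ?_ ?_
        ((integrable_tanhMeasure_inv hα).const_mul 2) ?_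
      · exact Filter.Eventually.of_forall fun ξ =>
          Measurable.aestronglyMeasurable (by fun_prop)
      · refine Filter.Eventually.of_forall fun ξ => ?_
        filter_upwards [ae_tanhMeasure_pos α] with s hs
        rw [Real.norm_of_nonneg (by positivity), div_le_iff₀ (by positivity)]
        field_simp
        nlinarith [sq_nonneg ξ]
      · filter_upwards [ae_tanhMeasure_pos α] with s hs
        have : ContinuousAt (fun ξ : ℝ => 2 * s / (s ^ 2 + ξ ^ 2)) 0 :=
          ContinuousAt.div (by fun_prop) (by fun_prop) (by positivity)
        exact this.tendsto.mono_left nhdsWithin_le_nhds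
    refine tendsto_nhds_unique h1 ?_
    rw [tanhSymbol, if_pos rfl]
    refine (tendsto_tanhSymbol α).congr' ?_
    filter_upwards [self_mem_nhdsWithin] with ξ hξ
    exact (integral_tanhMeasure_of_pos hα hξ).symm
  · exact integral_tanhMeasure_of_pos hα h

theorem tan_le_neg_one_of_mem {n : ℕ} {s : ℝ}
    (hs : s ∈ Ioc ((n + 1) * Real.pi - Real.pi / 2) ((n + 1) * Real.pi - Real.pi / 4)) :
    Real.tan s ≤ -1 := by
  have hp := Real.pi_pos
  have h1 : Real.tan s = Real.tan (s - (n + 1) * Real.pi) := by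
    have := Real.tan_periodic.sub_nat_mul_eq (n := n + 1) (x := s)
    push_cast at this
    exact this.symm
  have h2 : Real.tan (-(Real.pi / 4)) = -1 := by rw [Real.tan_neg, Real.tan_pi_div_four]
  rw [h1, ← h2]
  refine Real.strictMonoOn_tan.monotoneOn ⟨?_, ?_⟩ ⟨?_, ?_⟩ ?_ <;> linarith [hs.1, hs.2]

/-- Each of the `N` periods contains an interval of length `π / 4` on which `tan ≤ -1`, so that the
density there is at least `sin (απ) (Nπ)^(-α) / π`. -/
theorem le_tanhMeasure_Iic (hα : α ∈ Ioo (0 : ℝ) 1) {N : ℕ} (hN : 0 < N) :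
    ENNReal.ofReal (N * (Real.sin (α * Real.pi) * (N * Real.pi) ^ (-α) / 4)) ≤
      tanhMeasure α (Iic (N * Real.pi)) := by
  have hp := Real.pi_pos
  have hsin := sin_mul_pi_pos hα
  set I : ℕ → Set ℝ :=
    fun n => Ioc ((n + 1) * Real.pi - Real.pi / 2) ((n + 1) * Real.pi - Real.pi / 4) with hI
  have hsub : ⋃ n ∈ Finset.range N, I n ⊆ Iic (N * Real.pi) := by
    refine iUnion₂_subset fun n hn s hs => ?_
    have h1 : (n : ℝ) + 1 ≤ N := by exact_mod_cast Finset.mem_range.1 hn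
    have : (n + 1) * Real.pi ≤ N * Real.pi := by gcongr
    exact mem_Iic.2 (by linarith [hs.2])
  have hdisj : Pairwise (Function.onFun Disjoint I) := by
    refine (pairwise_disjoint_on I).2 fun m n hmn => ?_
    refine Set.disjoint_left.2 fun s hs hs' => ?_
    have h1 : (m : ℝ) + 1 ≤ n := by exact_mod_cast hmn
    have : (m + 1) * Real.pi ≤ n * Real.pi := by gcongr
    linarith [hs.2, hs'.1]
  have hIn : ∀ n ∈ Finset.range N,
      ENNReal.ofReal (Real.sin (α * Real.pi) * (N * Real.pi) ^ (-α) / 4) ≤ tanhMeasure α (I n) := by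
    intro n hn
    have h1 : (n : ℝ) + 1 ≤ N := by exact_mod_cast Finset.mem_range.1 hn
    have hN' : (n + 1) * Real.pi ≤ N * Real.pi := by gcongr
    have hn0 : (0 : ℝ) ≤ n * Real.pi := by positivity
    have hpos : I n ⊆ Ioi 0 := fun s hs => mem_Ioi.2 (by linarith [hs.1])
    rw [tanhMeasure, withDensity_apply _ measurableSet_Ioc,
      Measure.restrict_restrict measurableSet_Ioc, inter_eq_self_of_subset_left hpos]
    have hv : volume (I n) = ENNReal.ofReal (Real.pi / 4) := by
      rw [hI, Real.volume_Ioc]; congr 1; ring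
    have e : Real.sin (α * Real.pi) * (N * Real.pi) ^ (-α) / 4 =
        Real.sin (α * Real.pi) * (N * Real.pi) ^ (-α) / Real.pi * (Real.pi / 4) := by
      field_simp
    rw [e, ENNReal.ofReal_mul (by positivity), ← hv, ← setLIntegral_const]
    refine setLIntegral_mono (measurable_ofReal_tanhJump α) fun s hs => ?_
    have ht := tan_le_neg_one_of_mem hs
    have hs0 : 0 < s := hpos hs
    rw [tanhJump, if_pos (by linarith)]
    refine ENNReal.ofReal_le_ofReal ?_
    gcongr
    rw [Real.rpow_neg (by positivity), ← Real.inv_rpow (by positivity)]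
    refine Real.rpow_le_rpow (by positivity) ?_ hα.1.le
    rw [div_eq_mul_inv]
    have h3 : (N * Real.pi)⁻¹ ≤ s⁻¹ := by
      gcongr
      linarith [hs.2]
    have h4 : 0 < s⁻¹ := inv_pos.2 hs0
    nlinarith
  calc _ = ∑ n ∈ Finset.range N,
        ENNReal.ofReal (Real.sin (α * Real.pi) * (N * Real.pi) ^ (-α) / 4) := by
        rw [Finset.sum_const, Finset.card_range, nsmul_eq_mul, ENNReal.ofReal_mul (by positivity),
          ENNReal.ofReal_natCast]
    _ ≤ ∑ n ∈ Finset.range N, tanhMeasure α (I n) := Finset.sum_le_sum hIn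
    _ = tanhMeasure α (⋃ n ∈ Finset.range N, I n) :=
        (measure_biUnion_finset (fun i _ j _ h => hdisj h) fun _ _ => measurableSet_Ioc).symm
    _ ≤ _ := measure_mono hsub

theorem tanhMeasure_ne_zero (hα : α ∈ Ioo (0 : ℝ) 1) : tanhMeasure α ≠ 0 := by
  intro h
  have h1 := le_tanhMeasure_Iic hα (N := 1) one_pos
  have := sin_mul_pi_pos hα
  have := Real.pi_pos
  rw [h, Measure.coe_zero, Pi.zero_apply, nonpos_iff_eq_zero, ENNReal.ofReal_eq_zero] at h1
  refine h1.not_gt ?_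
  positivity

theorem integral_lt_integral_of_ae_lt {Ω : Type*} [MeasurableSpace Ω] {μ : Measure Ω} (hμ : μ ≠ 0)
    {f g : Ω → ℝ} (hf : Integrable f μ) (hg : Integrable g μ) (h : ∀ᵐ x ∂μ, f x < g x) :
    ∫ x, f x ∂μ < ∫ x, g x ∂μ := by
  rw [← sub_pos, ← integral_sub hg hf,
    integral_pos_iff_support_of_nonneg_ae (h.mono fun x hx => (sub_pos.2 hx).le) (hg.sub hf)]
  have h1 : Function.support (fun x => g x - f x) =ᵐ[μ] univ := by
    filter_upwards [h] with x hx
    exact eq_true (sub_pos.2 hx).ne'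
  rw [measure_congr h1]
  exact Measure.measure_univ_pos.2 hμ

/-- This is `u / β ≤ exp (u / β)` raised to the power `β`; it converts moments of the measure into
decay of its Laplace transform. -/
theorem exp_neg_le_rpow_mul {β u : ℝ} (hβ : 0 < β) (hu : 0 < u) :
    Real.exp (-u) ≤ β ^ β * u ^ (-β) := by
  have h1 : (u / β) ^ β ≤ Real.exp u := by
    have h2 : u / β ≤ Real.exp (u / β) := by linarith [Real.add_one_le_exp (u / β)]
    calc (u / β) ^ β ≤ Real.exp (u / β) ^ β := by gcongr
      _ = Real.exp u := by rw [← Real.exp_mul, div_mul_cancel₀ _ hβ.ne']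
  rw [Real.exp_neg, Real.rpow_neg hu.le, ← div_eq_mul_inv, inv_le_comm₀ (Real.exp_pos _)
    (by positivity), inv_div, ← Real.div_rpow hu.le hβ.le]
  exact h1

/-! ### The kernel as a Laplace transform -/

/-- The kernel with symbol `(tanh ξ / ξ) ^ α`. -/
noncomputable def tanhKernel (α x : ℝ) : ℝ := ∫ s, Real.exp (-(s * |x|)) ∂tanhMeasure α

theorem tanhKernel_neg (α x : ℝ) : tanhKernel α (-x) = tanhKernel α x := by
  simp [tanhKernel]

theorem tanhKernel_abs (α x : ℝ) : tanhKernel α |x| = tanhKernel α x := by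
  simp [tanhKernel]

theorem tanhKernel_of_pos (α : ℝ) {x : ℝ} (hx : 0 < x) :
    tanhKernel α x = ∫ s, Real.exp (-(s * x)) ∂tanhMeasure α := by
  rw [tanhKernel, abs_of_pos hx]

theorem tanhKernel_nonneg (α x : ℝ) : 0 ≤ tanhKernel α x :=
  integral_nonneg fun _ => (Real.exp_pos _).le

theorem measurable_tanhKernel (α : ℝ) : Measurable (tanhKernel α) := by
  have h : StronglyMeasurable (Function.uncurry fun x s : ℝ => Real.exp (-(s * |x|))) :=
    Measurable.stronglyMeasurable (by fun_prop)
  exact h.integral_prod_right.measurable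

theorem exp_neg_mul_le_rpow_mul {β x s : ℝ} (hβ : 0 < β) (hx : 0 < x) (hs : 0 < s) :
    Real.exp (-(s * x)) ≤ β ^ β * x ^ (-β) * s ^ (-β) := by
  have := exp_neg_le_rpow_mul hβ (mul_pos hs hx)
  rw [Real.mul_rpow hs.le hx.le] at this
  linarith

theorem integrable_tanhMeasure_exp (hα : α ∈ Ioo (0 : ℝ) 1) {x : ℝ} (hx : 0 < x) :
    Integrable (fun s => Real.exp (-(s * x))) (tanhMeasure α) := by
  refine Integrable.mono' ((integrable_tanhMeasure_rpow hα (β := 1)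
    (by linarith [hα.1])).const_mul (1 ^ (1 : ℝ) * x ^ (-1 : ℝ)))
    (Measurable.aestronglyMeasurable (by fun_prop)) ?_
  filter_upwards [ae_tanhMeasure_pos α] with s hs
  rw [Real.norm_of_nonneg (Real.exp_pos _).le]
  exact exp_neg_mul_le_rpow_mul one_pos hx hs

theorem tanhKernel_le_rpow (hα : α ∈ Ioo (0 : ℝ) 1) {β : ℝ} (hβ : 1 - α < β) :
    ∃ C : ℝ, 0 < C ∧ ∀ x : ℝ, 0 < x → tanhKernel α x ≤ C * x ^ (-β) := by
  have hβ0 : 0 < β := by linarith [hα.2]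
  have hi := integrable_tanhMeasure_rpow hα hβ
  have hnn : 0 ≤ ∫ s, s ^ (-β) ∂tanhMeasure α :=
    integral_nonneg_of_ae ((ae_tanhMeasure_pos α).mono fun s hs => Real.rpow_nonneg hs.le _)
  -- The added `1` only makes the constant visibly positive.
  refine ⟨β ^ β * ((∫ s, s ^ (-β) ∂tanhMeasure α) + 1), by positivity, fun x hx => ?_⟩
  have h1 : tanhKernel α x ≤ ∫ s, β ^ β * x ^ (-β) * s ^ (-β) ∂tanhMeasure α := by
    rw [tanhKernel_of_pos α hx]
    refine integral_mono_ae (integrable_tanhMeasure_exp hα hx) (hi.const_mul _) ?_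
    filter_upwards [ae_tanhMeasure_pos α] with s hs
    exact exp_neg_mul_le_rpow_mul hβ0 hx hs
  rw [integral_const_mul] at h1
  have h2 : 0 ≤ β ^ β * x ^ (-β) := by positivity
  nlinarith

theorem tanhKernel_pos (hα : α ∈ Ioo (0 : ℝ) 1) {x : ℝ} (hx : x ≠ 0) : 0 < tanhKernel α x := by
  have : NeZero (tanhMeasure α) := ⟨tanhMeasure_ne_zero hα⟩
  exact integral_exp_pos (integrable_tanhMeasure_exp hα (abs_pos.2 hx))

theorem strictAntiOn_tanhKernel (hα : α ∈ Ioo (0 : ℝ) 1) : StrictAntiOn (tanhKernel α) (Ioi 0) := by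
  intro x hx y hy hxy
  rw [tanhKernel_of_pos α hx, tanhKernel_of_pos α hy]
  refine integral_lt_integral_of_ae_lt (tanhMeasure_ne_zero hα) (integrable_tanhMeasure_exp hα hy)
    (integrable_tanhMeasure_exp hα hx) ?_
  filter_upwards [ae_tanhMeasure_pos α] with s hs
  rw [Real.exp_lt_exp]
  nlinarith

/-- Each `x ↦ exp (-s x)` with `s > 0` is strictly convex, and strictness survives integration
against a nonzero measure. -/
theorem strictConvexOn_tanhKernel_Ioi (hα : α ∈ Ioo (0 : ℝ) 1) :
    StrictConvexOn ℝ (Ioi 0) (tanhKernel α) := by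
  refine ⟨convex_Ioi 0, fun x hx y hy hxy a b ha hb hab => ?_⟩
  have hx : 0 < x := hx
  have hy : 0 < y := hy
  have hz : 0 < a • x + b • y := by simp only [smul_eq_mul]; positivity
  have hix := integrable_tanhMeasure_exp hα hx
  have hiy := integrable_tanhMeasure_exp hα hy
  rw [tanhKernel_of_pos α hx, tanhKernel_of_pos α hy, tanhKernel_of_pos α hz, smul_eq_mul a (∫ _, _ ∂_),
    smul_eq_mul b (∫ _, _ ∂_), ← integral_const_mul, ← integral_const_mul,
    ← integral_add (hix.const_mul a) (hiy.const_mul b)]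
  refine integral_lt_integral_of_ae_lt (tanhMeasure_ne_zero hα) (integrable_tanhMeasure_exp hα hz)
    ((hix.const_mul a).add (hiy.const_mul b)) ?_
  filter_upwards [ae_tanhMeasure_pos α] with s hs
  have hne : -(s * x) ≠ -(s * y) := by
    intro h
    exact hxy (mul_left_cancel₀ hs.ne' (neg_injective h))
  have := strictConvexOn_exp.2 (mem_univ (-(s * x))) (mem_univ (-(s * y))) hne ha hb hab
  rw [smul_eq_mul, smul_eq_mul, smul_eq_mul, smul_eq_mul] at this
  have e : -(s * (a * x + b * y)) = a * -(s * x) + b * -(s * y) := by ring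
  simpa only [smul_eq_mul, e] using this

theorem strictConvexOn_tanhKernel_Iio (hα : α ∈ Ioo (0 : ℝ) 1) :
    StrictConvexOn ℝ (Iio 0) (tanhKernel α) := by
  refine ⟨convex_Iio 0, fun x hx y hy hxy a b ha hb hab => ?_⟩
  have := (strictConvexOn_tanhKernel_Ioi hα).2 (x := -x) (by simpa using hx) (y := -y)
    (by simpa using hy) (fun h => hxy (neg_injective h)) ha hb hab
  rw [tanhKernel_neg, tanhKernel_neg, smul_neg, smul_neg, ← neg_add, tanhKernel_neg] at this
  exact this

/-- The kernel is the moment generating function of the measure at `-|x|`. This is analytic on the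
negative half-line, and `|x|` is smooth off the origin. -/
theorem contDiffOn_tanhKernel (hα : α ∈ Ioo (0 : ℝ) 1) : ContDiffOn ℝ ∞ (tanhKernel α) {0}ᶜ := by
  have hsub : Iio 0 ⊆ interior (ProbabilityTheory.integrableExpSet id (tanhMeasure α)) := by
    refine interior_maximal (fun t ht => ?_) isOpen_Iio
    have := integrable_tanhMeasure_exp hα (neg_pos.2 (show t < 0 from ht))
    refine this.congr (Filter.Eventually.of_forall fun s => ?_)
    simp [mul_comm]
  have h1 : ContDiffOn ℝ ∞ (ProbabilityTheory.mgf id (tanhMeasure α)) (Iio 0) :=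
    (ProbabilityTheory.analyticOn_mgf.mono hsub).contDiffOn
      (uniqueDiffOn_Iio 0)
  intro x hx
  have hx : x ≠ 0 := hx
  have h2 : ContDiffAt ℝ ∞ (ProbabilityTheory.mgf id (tanhMeasure α)) (-|x|) :=
    h1.contDiffAt (Iio_mem_nhds (neg_neg_of_pos (abs_pos.2 hx)))
  have h3 : ContDiffAt ℝ ∞ (fun x : ℝ => -|x|) x := (contDiffAt_abs hx).neg
  have h4 : tanhKernel α = ProbabilityTheory.mgf id (tanhMeasure α) ∘ fun x => -|x| := by
    ext x
    simp [tanhKernel, ProbabilityTheory.mgf, mul_comm]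
  rw [h4]
  exact (ContDiffAt.comp x h2 h3).contDiffWithinAt

theorem le_tanhKernel (hα : α ∈ Ioo (0 : ℝ) 1) :
    ∃ c : ℝ, 0 < c ∧ ∀ x : ℝ, 0 < x → x ≤ 1 → c * x ^ (α - 1) ≤ tanhKernel α x := by
  have hp := Real.pi_pos
  have hsin := sin_mul_pi_pos hα
  refine ⟨Real.exp (-Real.pi) * (Real.sin (α * Real.pi) * Real.pi ^ (-α) / 4) * 2 ^ (α - 1),
    by positivity, fun x hx hx1 => ?_⟩
  -- With `N x ≤ 1` the exponential is at least `exp (-π)` for `s ≤ Nπ`, and `N ≥ 1 / (2x)` turns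
  -- the mass `N^(1-α)` into `x^(α-1)`.
  set N := ⌊x⁻¹⌋₊ with hN
  have h1 : 1 ≤ x⁻¹ := (one_le_inv₀ hx).2 hx1
  have hN1 : 1 ≤ N := Nat.one_le_floor_iff _ |>.2 h1
  have hN1' : (1 : ℝ) ≤ N := by exact_mod_cast hN1
  have hNle : (N : ℝ) ≤ x⁻¹ := Nat.floor_le (by positivity)
  have hNlt : x⁻¹ < N + 1 := Nat.lt_floor_add_one _
  have hNx : (N : ℝ) * x ≤ 1 := by
    calc (N : ℝ) * x ≤ x⁻¹ * x := by gcongr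
      _ = 1 := inv_mul_cancel₀ hx.ne'
  have hlow : Real.exp (-Real.pi) * (N * (Real.sin (α * Real.pi) * (N * Real.pi) ^ (-α) / 4)) ≤
      tanhKernel α x := by
    rw [← ENNReal.ofReal_le_ofReal_iff (tanhKernel_nonneg α x), tanhKernel_of_pos α hx,
      ofReal_integral_eq_lintegral_ofReal (integrable_tanhMeasure_exp hα hx)
        (Filter.Eventually.of_forall fun _ => (Real.exp_pos _).le),
      ENNReal.ofReal_mul (Real.exp_pos _).le]
    refine le_trans ?_ (mul_meas_ge_le_lintegral (μ := tanhMeasure α) (by fun_prop)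
      (ENNReal.ofReal (Real.exp (-Real.pi))))
    refine mul_le_mul_right ((le_tanhMeasure_Iic hα hN1).trans (measure_mono fun s hs => ?_)) _
    refine ENNReal.ofReal_le_ofReal (Real.exp_le_exp.2 (neg_le_neg ?_))
    have hs : s ≤ N * Real.pi := hs
    nlinarith
  refine le_trans ?_ hlow
  have hN0 : (0 : ℝ) < N := by linarith
  have e1 : (N : ℝ) * (N * Real.pi) ^ (-α) = Real.pi ^ (-α) * (N : ℝ) ^ (1 - α) := by
    rw [Real.mul_rpow hN0.le hp.le, sub_eq_add_neg, Real.rpow_add hN0, Real.rpow_one]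
    ring
  have e2 : (2 : ℝ) ^ (α - 1) * x ^ (α - 1) ≤ (N : ℝ) ^ (1 - α) := by
    rw [← Real.mul_rpow (by norm_num) hx.le, ← neg_sub 1 α, Real.rpow_neg (by positivity),
      ← Real.inv_rpow (by positivity), mul_inv]
    refine Real.rpow_le_rpow (by positivity) ?_ (by linarith [hα.2])
    linarith
  calc _ = Real.exp (-Real.pi) * (Real.sin (α * Real.pi) * Real.pi ^ (-α) / 4) *
        (2 ^ (α - 1) * x ^ (α - 1)) := by ring
    _ ≤ Real.exp (-Real.pi) * (Real.sin (α * Real.pi) * Real.pi ^ (-α) / 4) * (N : ℝ) ^ (1 - α) := by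
        gcongr
    _ = Real.exp (-Real.pi) * (Real.sin (α * Real.pi) * (Real.pi ^ (-α) * (N : ℝ) ^ (1 - α)) / 4) := by
        ring
    _ = _ := by rw [← e1]; ring

/-! ### The Fourier transform of the kernel -/

theorem integral_exp_neg_mul_abs_mul_cexp {s : ℝ} (hs : 0 < s) (ξ : ℝ) :
    Integrable (fun x : ℝ => (Real.exp (-(s * |x|)) : ℂ) * Complex.exp (-Complex.I * x * ξ)) ∧
    ∫ x : ℝ, (Real.exp (-(s * |x|)) : ℂ) * Complex.exp (-Complex.I * x * ξ) =
      ((2 * s / (s ^ 2 + ξ ^ 2) : ℝ) : ℂ) := by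
  set f := fun x : ℝ => (Real.exp (-(s * |x|)) : ℂ) * Complex.exp (-Complex.I * x * ξ) with hf
  set a : ℂ := -s - Complex.I * ξ with ha
  set b : ℂ := s - Complex.I * ξ with hb
  have hare : a.re = -s := by simp [ha]
  have hbre : b.re = s := by simp [hb]
  have e1 : ∀ x ∈ Ioi (0 : ℝ), Complex.exp (a * x) = f x := by
    intro x hx
    rw [hf, ha]
    simp only
    rw [abs_of_pos hx, Complex.ofReal_exp, ← Complex.exp_add]
    congr 1; push_cast; ring
  have e2 : ∀ x ∈ Iic (0 : ℝ), Complex.exp (b * x) = f x := by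
    intro x hx
    rw [hf, hb]
    simp only
    rw [abs_of_nonpos hx, Complex.ofReal_exp, ← Complex.exp_add]
    congr 1; push_cast; ring
  have hi1 : IntegrableOn f (Ioi 0) :=
    (integrableOn_exp_mul_complex_Ioi (by linarith) 0).congr_fun e1 measurableSet_Ioi
  have hi2 : IntegrableOn f (Iic 0) :=
    (integrableOn_exp_mul_complex_Iic (by linarith) 0).congr_fun e2 measurableSet_Iic
  have hi : Integrable f := by
    rw [← integrableOn_univ, ← Iic_union_Ioi (a := (0 : ℝ))]
    exact hi2.union hi1
  refine ⟨hi, ?_⟩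
  rw [← intervalIntegral.integral_Iic_add_Ioi hi2 hi1, ← setIntegral_congr_fun measurableSet_Ioi e1,
    ← setIntegral_congr_fun measurableSet_Iic e2, integral_exp_mul_complex_Ioi (by linarith),
    integral_exp_mul_complex_Iic (by linarith)]
  have ha0 : a ≠ 0 := fun h => by rw [h] at hare; simp at hare; linarith
  have hb0 : b ≠ 0 := fun h => by rw [h] at hbre; simp at hbre; linarith
  have hd : (s : ℂ) ^ 2 + ξ ^ 2 = -(a * b) := by
    rw [ha, hb]
    linear_combination ((ξ : ℂ) ^ 2) * Complex.I_sq
  push_cast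
  rw [hd, mul_zero, mul_zero, Complex.exp_zero]
  field_simp
  rw [ha, hb]
  ring

/-- The `L¹` norm of `exp (-s|x|)` is `2 / s`, and `s⁻¹` is integrable for the measure because `1 >
1 - α`. This justifies Fubini. -/
theorem integrable_prod_tanhKernel (hα : α ∈ Ioo (0 : ℝ) 1) (ξ : ℝ) :
    Integrable (Function.uncurry fun (x s : ℝ) =>
      (Real.exp (-(s * |x|)) : ℂ) * Complex.exp (-Complex.I * x * ξ))
      ((volume : Measure ℝ).prod (tanhMeasure α)) := by
  rw [integrable_prod_iff' (Measurable.aestronglyMeasurable (by fun_prop))]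
  constructor
  · filter_upwards [ae_tanhMeasure_pos α] with s hs
    exact (integral_exp_neg_mul_abs_mul_cexp hs ξ).1
  · refine ((integrable_tanhMeasure_inv hα).const_mul 2).congr ?_
    filter_upwards [ae_tanhMeasure_pos α] with s hs
    have h1 := (integral_exp_neg_mul_abs_mul_cexp hs 0).2
    simp only [Complex.ofReal_zero, mul_zero, Complex.exp_zero, mul_one] at h1
    rw [integral_complex_ofReal, Complex.ofReal_inj] at h1
    have h2 : ∀ x : ℝ, ‖(Real.exp (-(s * |x|)) : ℂ) * Complex.exp (-Complex.I * x * ξ)‖ =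
        Real.exp (-(s * |x|)) := by
      intro x
      rw [norm_mul, Complex.norm_exp, Complex.norm_real, Real.norm_of_nonneg (Real.exp_pos _).le]
      simp
    simp only [Function.uncurry]
    simp_rw [h2, h1]
    field_simp
    ring

theorem integrable_tanhKernel (hα : α ∈ Ioo (0 : ℝ) 1) : Integrable (tanhKernel α) := by
  have h := (integrable_prod_tanhKernel hα 0).integral_prod_left
  simp only [Function.uncurry, Complex.ofReal_zero, mul_zero, Complex.exp_zero, mul_one] at h
  have h2 := h.re
  refine h2.congr (Filter.Eventually.of_forall fun x => ?_)
  simp only [RCLike.re_to_complex]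
  rw [integral_complex_ofReal, Complex.ofReal_re]
  rfl

theorem fourier_tanhKernel (hα : α ∈ Ioo (0 : ℝ) 1) (ξ : ℝ) :
    ∫ x : ℝ, (tanhKernel α x : ℂ) * Complex.exp (-Complex.I * x * ξ) = (tanhSymbol α ξ : ℂ) := by
  have h := integral_integral_swap (integrable_prod_tanhKernel hα ξ)
  have h1 : ∀ x : ℝ, ∫ s, (Real.exp (-(s * |x|)) : ℂ) * Complex.exp (-Complex.I * x * ξ)
      ∂tanhMeasure α = (tanhKernel α x : ℂ) * Complex.exp (-Complex.I * x * ξ) := by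
    intro x
    rw [integral_mul_const, integral_complex_ofReal]
    rfl
  simp_rw [h1] at h
  rw [h, ← integral_tanhMeasure hα ξ, ← integral_complex_ofReal]
  refine integral_congr_ae ?_
  filter_upwards [ae_tanhMeasure_pos α] with s hs
  exact (integral_exp_neg_mul_abs_mul_cexp hs ξ).2

theorem integral_tanhKernel (hα : α ∈ Ioo (0 : ℝ) 1) : ∫ x, tanhKernel α x = 1 := by
  have h := fourier_tanhKernel hα 0
  simp only [Complex.ofReal_zero, mul_zero, Complex.exp_zero, mul_one] at h
  rw [integral_complex_ofReal, Complex.ofReal_inj] at h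
  rw [h, tanhSymbol, if_pos rfl]

/-! ### Integrability and bell shape -/

theorem memLp_tanhKernel (hα : α ∈ Ioo (0 : ℝ) 1) {p : ℝ≥0∞} (hp : 0 < p)
    (hp' : p < ENNReal.ofReal (1 / (1 - α))) : MemLp (tanhKernel α) p := by
  have hα1 : 0 < 1 - α := by linarith [hα.2]
  have hpt : p ≠ ⊤ := (hp'.trans ENNReal.ofReal_lt_top).ne
  have hq : 0 < p.toReal := ENNReal.toReal_pos hp.ne' hpt
  have hq' : p.toReal < 1 / (1 - α) := by
    rwa [← ENNReal.ofReal_toReal hpt, ENNReal.ofReal_lt_ofReal_iff (by positivity)] at hp'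
  set q := p.toReal with hqdef
  have hlt : 1 - α < 1 / q := by
    rw [lt_div_iff₀ hq]; rw [lt_div_iff₀ hα1] at hq'; linarith
  have key : ∀ β : ℝ, 1 - α < β → ∃ C : ℝ, ∀ x : ℝ, 0 < x →
      ‖tanhKernel α x‖ ^ q ≤ C * x ^ (-(β * q)) := by
    intro β hβ
    obtain ⟨C, hC, hb⟩ := tanhKernel_le_rpow hα hβ
    refine ⟨C ^ q, fun x hx => ?_⟩
    rw [Real.norm_of_nonneg (tanhKernel_nonneg α x), ← neg_mul, Real.rpow_mul hx.le,
      ← Real.mul_rpow hC.le (by positivity)]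
    exact Real.rpow_le_rpow (tanhKernel_nonneg α x) (hb x hx) hq.le
  have hm : Measurable fun x => ‖tanhKernel α x‖ ^ q := (measurable_tanhKernel α).norm.pow_const q
  rw [← integrable_norm_rpow_iff (measurable_tanhKernel α).aestronglyMeasurable hp.ne' hpt]
  have h1 : IntegrableOn (fun x => ‖tanhKernel α x‖ ^ q) (Ioc 0 1) := by
    -- A `β` strictly between `1 - α` and `1 / q`, so that `β q < 1`.
    obtain ⟨C, hC⟩ := key ((1 - α + 1 / q) / 2) (by linarith)
    have hexp : -1 < -((1 - α + 1 / q) / 2 * q) := by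
      have : (1 - α + 1 / q) / 2 * q < 1 / q * q :=
        mul_lt_mul_of_pos_right (by linarith) hq
      rw [one_div_mul_cancel hq.ne'] at this
      linarith
    have hi := (intervalIntegrable_iff_integrableOn_Ioc_of_le zero_le_one).1
      (intervalIntegral.intervalIntegrable_rpow' (a := 0) (b := 1) hexp)
    refine Integrable.mono' (hi.const_mul C) hm.aestronglyMeasurable ?_
    filter_upwards [ae_restrict_mem measurableSet_Ioc] with x hx
    rw [Real.norm_of_nonneg (by positivity)]
    exact hC x hx.1
  have h2 : IntegrableOn (fun x => ‖tanhKernel α x‖ ^ q) (Ioi 1) := by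
    -- Here `β q = 2 + q > 1`.
    obtain ⟨C, hC⟩ := key (2 / q + 1) (by have : 0 < 1 / q := by positivity
                                          have : 2 / q = 1 / q + 1 / q := by ring
                                          linarith)
    have hexp : -((2 / q + 1) * q) < -1 := by
      have : (2 / q + 1) * q = 2 + q := by field_simp
      linarith
    refine Integrable.mono' ((integrableOn_Ioi_rpow_of_lt hexp one_pos).const_mul C)
      hm.aestronglyMeasurable ?_
    filter_upwards [ae_restrict_mem measurableSet_Ioi] with x hx
    rw [Real.norm_of_nonneg (by positivity)]
    exact hC x (one_pos.trans hx)
  have h3 : IntegrableOn (fun x => ‖tanhKernel α x‖ ^ q) (Ioi 0) := by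
    rw [← Ioc_union_Ioi_eq_Ioi zero_le_one]
    exact h1.union h2
  refine integrable_of_integrableOn_Ioi ?_ h3
  simpa only [tanhKernel_neg] using h3

theorem lt_of_memLp_tanhKernel (hα : α ∈ Ioo (0 : ℝ) 1) {p : ℝ≥0∞} (h : MemLp (tanhKernel α) p) :
    p < ENNReal.ofReal (1 / (1 - α)) := by
  by_contra! hp
  have hα1 : 0 < 1 - α := by linarith [hα.2]
  have hq : 0 < 1 / (1 - α) := by positivity
  -- On a set of finite measure it suffices to refute the endpoint exponent, where `x^(α-1)` becomes
  -- `x⁻¹`; this covers `p = ⊤` too.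
  have h1 : MemLp (tanhKernel α) (ENNReal.ofReal (1 / (1 - α))) (volume.restrict (Ioc 0 1)) :=
    (h.restrict _).mono_exponent hp
  rw [← integrable_norm_rpow_iff h1.1 (by simpa using hα.2) ENNReal.ofReal_ne_top,
    ENNReal.toReal_ofReal hq.le] at h1
  obtain ⟨c, hc, hb⟩ := le_tanhKernel hα
  have h2 : IntegrableOn (fun x : ℝ => x⁻¹) (Ioc 0 1) := by
    refine Integrable.mono' (h1.const_mul ((c ^ (1 / (1 - α)))⁻¹))
      (Measurable.aestronglyMeasurable (by fun_prop)) ?_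
    filter_upwards [ae_restrict_mem measurableSet_Ioc] with x hx
    have hx0 : 0 < x := hx.1
    rw [Real.norm_of_nonneg (by positivity), Real.norm_of_nonneg (tanhKernel_nonneg α x),
      inv_mul_eq_div, le_div_iff₀ (by positivity), mul_comm]
    calc c ^ (1 / (1 - α)) * x⁻¹ = (c * x ^ (α - 1)) ^ (1 / (1 - α)) := by
          rw [Real.mul_rpow hc.le (by positivity), ← Real.rpow_mul hx0.le, ← Real.rpow_neg_one]
          congr 2
          field_simp
          ring
      _ ≤ _ := Real.rpow_le_rpow (by positivity) (hb x hx0 hx.2) hq.le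
  have h3 := (intervalIntegrable_iff_integrableOn_Ioc_of_le zero_le_one).2 h2
  rw [intervalIntegrable_inv_iff] at h3
  simp at h3

/-- The approximant is the kernel with its peak cut off, `K (max |x| r)`. The error lives on `(-r,
r)` and is at most `K` almost everywhere, so it is small by absolute continuity of the `L^p` norm.
-/
theorem isBellShaped_tanhKernel (hα : α ∈ Ioo (0 : ℝ) 1) {p : ℝ≥0∞} (hp : 1 ≤ p)
    (hp' : p < ENNReal.ofReal (1 / (1 - α))) : IsBellShaped p (tanhKernel α) := by
  have hL := memLp_tanhKernel hα (one_pos.trans_le hp) hp'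
  have hpt : p ≠ ⊤ := (hp'.trans ENNReal.ofReal_lt_top).ne
  refine ⟨hL, fun ε hε => ?_⟩
  obtain ⟨η, -, hη, hηε⟩ := ENNReal.lt_iff_exists_real_btwn.1 hε
  have hη0 : 0 < η := by simpa using hη
  obtain ⟨δ, hδ, hδs⟩ := hL.eLpNorm_indicator_le hp hpt hη0
  set r := δ / 2 with hr
  have hr0 : 0 < r := by positivity
  have hmax : ∀ x : ℝ, 0 < max |x| r := fun x => lt_max_of_lt_right hr0
  have hcont : Continuous fun x : ℝ => tanhKernel α (max |x| r) := by
    have h1 : ContinuousOn (tanhKernel α) {0}ᶜ := (contDiffOn_tanhKernel hα).continuousOn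
    exact h1.comp_continuous (by fun_prop) fun x => (hmax x).ne'
  have hle : ∀ x : ℝ, x ≠ 0 → tanhKernel α (max |x| r) ≤ tanhKernel α x := by
    intro x hx
    rw [← tanhKernel_abs α x]
    exact (strictAntiOn_tanhKernel hα).antitoneOn (abs_pos.2 hx) (hmax x) (le_max_left _ _)
  have hne : ∀ᵐ x : ℝ, x ≠ 0 := by simp [ae_iff]
  refine ⟨fun x => tanhKernel α (max |x| r), ?_, hcont, fun x => by simp only [abs_neg],
    fun x => tanhKernel_pos hα (hmax x).ne', ?_, ?_⟩
  · refine hL.mono hcont.aestronglyMeasurable (hne.mono fun x hx => ?_)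
    rw [Real.norm_of_nonneg (tanhKernel_nonneg _ _), Real.norm_of_nonneg (tanhKernel_nonneg _ _)]
    exact hle x hx
  · intro x hx y hy hxy
    have hx : 0 ≤ x := hx
    refine (strictAntiOn_tanhKernel hα).antitoneOn (hmax x) (hmax y) ?_
    rw [abs_of_nonneg hx, abs_of_nonneg (hx.trans hxy)]
    exact max_le_max_right r hxy
  · refine lt_of_le_of_lt ?_ hηε
    refine le_trans ?_ (hδs (Ioo (-r) r) measurableSet_Ioo ?_)
    · refine eLpNorm_mono_ae (hne.mono fun x hx => ?_)
      beta_reduce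
      by_cases hxr : |x| < r
      · rw [indicator_of_mem (show x ∈ Ioo (-r) r from abs_lt.1 hxr),
          Real.norm_of_nonneg (sub_nonneg.2 (hle x hx)),
          Real.norm_of_nonneg (tanhKernel_nonneg _ _)]
        linarith [tanhKernel_nonneg α (max |x| r)]
      · rw [max_eq_left (not_lt.1 hxr), tanhKernel_abs, sub_self, norm_zero]
        exact norm_nonneg _
    · rw [Real.volume_Ioo]
      exact ENNReal.ofReal_le_ofReal (by rw [hr]; linarith)

/-! ### Convolution with a probability density -/

theorem lintegral_ofReal_sub_left {K : ℝ → ℝ} (hi : Integrable K) (hK : 0 ≤ K)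
    (h1 : ∫ x, K x = 1) (x : ℝ) : ∫⁻ y, ENNReal.ofReal (K (x - y)) = 1 := by
  rw [lintegral_sub_left_eq_self (fun y => ENNReal.ofReal (K y)) x,
    ← ofReal_integral_eq_lintegral_ofReal hi (Filter.Eventually.of_forall hK), h1,
    ENNReal.ofReal_one]

/-- Convolution with a probability density is a contraction of every `L^p`. -/
theorem isConvolutionBound_one {K : ℝ → ℝ} (hm : Measurable K) (hi : Integrable K) (hK : 0 ≤ K)
    (h1 : ∫ x, K x = 1) {p : ℝ≥0∞} (hp : 1 ≤ p) : IsConvolutionBound K p 1 := by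
  intro f hf
  rw [one_mul]
  have hmx : ∀ x : ℝ, Measurable fun y => ENNReal.ofReal (K (x - y)) := fun x =>
    (hm.comp (by fun_prop)).ennreal_ofReal
  set ν : ℝ → Measure ℝ := fun x => volume.withDensity fun y => ENNReal.ofReal (K (x - y)) with hν
  have hac : ∀ x, ν x ≪ volume := fun x => withDensity_absolutelyContinuous _ _
  have hprob : ∀ x, IsProbabilityMeasure (ν x) := fun x =>
    ⟨by rw [hν, withDensity_apply _ MeasurableSet.univ, Measure.restrict_univ,
      lintegral_ofReal_sub_left hi hK h1]⟩
  have hfν : ∀ x, AEStronglyMeasurable f (ν x) := fun x => hf.1.mono_ac (hac x)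
  have hlint : ∀ (g : ℝ → ℝ≥0∞), AEMeasurable g → ∀ x,
      ∫⁻ y, g y ∂ν x = ∫⁻ y, ENNReal.ofReal (K (x - y)) * g y := by
    intro g hg x
    rw [hν, lintegral_withDensity_eq_lintegral_mul₀ (hmx x).aemeasurable hg]
    rfl
  -- For the probability measure `K (x - y) dy` the `L¹` norm is at most the `L^p` norm; Tonelli
  -- then integrates out `x`.
  have hpt : ∀ x, ‖∫ y, K (x - y) * f y‖ₑ ≤ eLpNorm f p (ν x) := by
    intro x
    refine le_trans ?_ (eLpNorm_le_eLpNorm_of_exponent_le hp (hfν x))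
    rw [eLpNorm_one_eq_lintegral_enorm, hlint _ hf.1.enorm]
    refine (enorm_integral_le_lintegral_enorm _).trans (lintegral_mono fun y => ?_)
    rw [enorm_mul, Real.enorm_of_nonneg (hK _)]
  by_cases hpi : p = ⊤
  · subst hpi
    rw [eLpNorm_exponent_top]
    refine eLpNormEssSup_le_of_ae_enorm_bound (Filter.Eventually.of_forall fun x => ?_)
    refine (hpt x).trans ?_
    rw [eLpNorm_exponent_top, eLpNorm_exponent_top]
    exact eLpNormEssSup_mono_measure f (hac x)
  have hp0 : p ≠ 0 := (one_pos.trans_le hp).ne'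
  have hq : 0 < p.toReal := ENNReal.toReal_pos hp0 hpi
  rw [eLpNorm_eq_lintegral_rpow_enorm_toReal hp0 hpi, eLpNorm_eq_lintegral_rpow_enorm_toReal hp0 hpi]
  refine ENNReal.rpow_le_rpow ?_ (by positivity)
  have hgm : AEMeasurable (fun y => ‖f y‖ₑ ^ p.toReal) := hf.1.enorm.pow_const _
  calc ∫⁻ x, ‖∫ y, K (x - y) * f y‖ₑ ^ p.toReal
      ≤ ∫⁻ x, ∫⁻ y, ENNReal.ofReal (K (x - y)) * ‖f y‖ₑ ^ p.toReal := by
        refine lintegral_mono fun x => ?_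
        rw [← hlint _ hgm]
        refine (ENNReal.rpow_le_rpow (hpt x) hq.le).trans ?_
        rw [eLpNorm_eq_lintegral_rpow_enorm_toReal hp0 hpi, ← ENNReal.rpow_mul,
          one_div_mul_cancel hq.ne', ENNReal.rpow_one]
    _ = ∫⁻ y, ∫⁻ x, ENNReal.ofReal (K (x - y)) * ‖f y‖ₑ ^ p.toReal := by
        refine lintegral_lintegral_swap ?_
        refine AEMeasurable.mul ?_ hgm.comp_snd
        have hsub : Measurable fun z : ℝ × ℝ => z.1 - z.2 := by fun_prop
        exact (hm.comp hsub).ennreal_ofReal.aemeasurable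
    _ = ∫⁻ y, ‖f y‖ₑ ^ p.toReal := by
        refine lintegral_congr fun y => ?_
        have hmy : Measurable fun x => ENNReal.ofReal (K (x - y)) :=
          (hm.comp (by fun_prop)).ennreal_ofReal
        rw [lintegral_mul_const _ hmy,
          lintegral_sub_right_eq_self (fun x => ENNReal.ofReal (K x)) y,
          ← ofReal_integral_eq_lintegral_ofReal hi (Filter.Eventually.of_forall hK), h1,
          ENNReal.ofReal_one, one_mul]

/-- Testing convolution against the indicator function of a long interval. -/
theorem le_of_isConvolutionBound {K : ℝ → ℝ} (hi : Integrable K) (hK : 0 ≤ K) {p C : ℝ≥0∞}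
    (hp : 1 ≤ p) (hC : IsConvolutionBound K p C) {A R : ℝ} (hA : 0 < A) (hR : 0 < R) :
    ENNReal.ofReal (∫ x in (-A)..A, K x) ≤ C * ENNReal.ofReal ((R + A) / R) := by
  have hp0 : p ≠ 0 := (one_pos.trans_le hp).ne'
  -- For `p = ⊤` the conventions give `t = 1 / 0 = 0`, the correct exponent.
  set t := 1 / p.toReal with ht
  have ht0 : 0 ≤ t := by positivity
  have ht1 : t ≤ 1 := by
    by_cases hpi : p = ⊤
    · simp [ht, hpi]
    · rw [ht]
      have : 1 ≤ p.toReal := by simpa using ENNReal.toReal_mono hpi hp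
      exact div_le_one_of_le₀ this (by positivity)
  set κ := ∫ x in (-A)..A, K x with hκ
  have hκ0 : 0 ≤ κ := intervalIntegral.integral_nonneg (by linarith) fun x _ => hK x
  -- Wide enough that `f (x - u) = 1` whenever `|x| ≤ R` and `|u| ≤ A`.
  set J := Icc (-(R + A)) (R + A) with hJ
  set f : ℝ → ℝ := J.indicator fun _ => 1 with hf
  have hfL : MemLp f p := memLp_indicator_const p measurableSet_Icc 1 (Or.inr (by simp))
  have hlow : ∀ x ∈ Icc (-R) R, κ ≤ ∫ y, K (x - y) * f y := by
    intro x hx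
    have e : ∫ y, K (x - y) * f y = ∫ u, K u * f (x - u) := by
      rw [← integral_sub_left_eq_self (fun u => K u * f (x - u)) volume x]
      simp
    rw [e, hκ, intervalIntegral.integral_of_le (by linarith), ← integral_indicator measurableSet_Ioc]
    have hfm : Measurable f := measurable_const.indicator measurableSet_Icc
    refine integral_mono (hi.indicator measurableSet_Ioc) ?_ fun u => ?_
    · refine hi.mul_bdd (c := 1) (hfm.comp (by fun_prop)).aestronglyMeasurable
        (Filter.Eventually.of_forall fun u => ?_)
      rw [hf]
      exact (norm_indicator_le_norm_self _ _).trans (by simp)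
    · by_cases hu : u ∈ Ioc (-A) A
      · have : x - u ∈ J := ⟨by linarith [hx.1, hu.2], by linarith [hx.2, hu.1]⟩
        simp only [hf, indicator_of_mem hu, indicator_of_mem this, mul_one, le_refl]
      · rw [indicator_of_notMem hu]
        exact mul_nonneg (hK u) (indicator_nonneg (fun _ _ => zero_le_one) _)
  have h1 : eLpNorm ((Icc (-R) R).indicator fun _ => κ) p ≤ C * eLpNorm f p := by
    refine le_trans (eLpNorm_mono fun x => ?_) (hC f hfL)
    by_cases hx : x ∈ Icc (-R) R
    · rw [indicator_of_mem hx, Real.norm_of_nonneg hκ0]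
      exact (hlow x hx).trans (Real.le_norm_self _)
    · rw [indicator_of_notMem hx, norm_zero]
      exact norm_nonneg _
  have hv1 : volume (Icc (-R) R) = ENNReal.ofReal (2 * R) := by
    rw [Real.volume_Icc]; congr 1; ring
  have hv2 : volume J = ENNReal.ofReal (2 * R) * ENNReal.ofReal ((R + A) / R) := by
    rw [hJ, Real.volume_Icc, ← ENNReal.ofReal_mul (by positivity)]; congr 1; field_simp; ring
  have h2R : ENNReal.ofReal (2 * R) ≠ 0 := by simpa using hR
  have hratio : 1 ≤ (R + A) / R := by rw [le_div_iff₀ hR]; linarith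
  rw [eLpNorm_indicator_const' measurableSet_Icc (by rwa [hv1]) hp0, hf,
    eLpNorm_indicator_const' measurableSet_Icc ?_ hp0, hv1, hv2, ← ht,
    ENNReal.mul_rpow_of_nonneg _ _ ht0, Real.enorm_of_nonneg hκ0, enorm_one, one_mul,
    mul_left_comm, mul_comm] at h1
  · have h3 : ENNReal.ofReal (2 * R) ^ t ≠ 0 := by simp [ENNReal.rpow_eq_zero_iff, hR, ht0.not_gt]
    have h4 : ENNReal.ofReal (2 * R) ^ t ≠ ⊤ := ENNReal.rpow_ne_top_of_nonneg ht0 ENNReal.ofReal_ne_top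
    refine ((ENNReal.mul_le_mul_iff_right h3 h4).1 h1).trans ?_
    gcongr
    calc ENNReal.ofReal ((R + A) / R) ^ t ≤ ENNReal.ofReal ((R + A) / R) ^ (1 : ℝ) :=
          ENNReal.rpow_le_rpow_of_exponent_le (by simpa using hratio) ht1
      _ = _ := ENNReal.rpow_one _
  · rw [hv2]
    exact mul_ne_zero h2R (by simp; positivity)

theorem one_le_of_isConvolutionBound {K : ℝ → ℝ} (hi : Integrable K) (hK : 0 ≤ K)
    (h1 : ∫ x, K x = 1) {p C : ℝ≥0∞} (hp : 1 ≤ p) (hC : IsConvolutionBound K p C) : 1 ≤ C := by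
  have hA : Filter.Tendsto (fun n : ℕ => ENNReal.ofReal (∫ x in (-(n : ℝ))..n, K x)) Filter.atTop
      (nhds 1) := by
    rw [← ENNReal.ofReal_one, ← h1]
    exact ENNReal.tendsto_ofReal (intervalIntegral_tendsto_integral hi
      (Filter.tendsto_neg_atTop_atBot.comp (tendsto_natCast_atTop_atTop (R := ℝ)))
      tendsto_natCast_atTop_atTop)
  have hB : Filter.Tendsto (fun n : ℕ => C * ENNReal.ofReal (1 + 1 / n)) Filter.atTop
      (nhds (C * 1)) := by
    refine ENNReal.Tendsto.const_mul ?_ (Or.inl one_ne_zero)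
    rw [← ENNReal.ofReal_one]
    refine ENNReal.tendsto_ofReal ?_
    simpa using tendsto_one_div_atTop_nhds_zero_nat.const_add (1 : ℝ)
  rw [mul_one] at hB
  refine le_of_tendsto_of_tendsto hA hB ?_
  filter_upwards [Filter.eventually_gt_atTop 0] with n hn
  have hn : (0 : ℝ) < n := by exact_mod_cast hn
  -- With `A = n` and `R = n²` the mass on `[-A, A]` and the ratio `(R + A) / R` both tend to `1`.
  have := le_of_isConvolutionBound hi hK hp hC hn (R := n ^ 2) (by positivity)
  rwa [show ((n : ℝ) ^ 2 + n) / n ^ 2 = 1 + 1 / n by field_simp] at this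

/-! ### The kernel as a tempered distribution, and uniqueness -/

theorem norm_cexp_neg_I_mul (x ξ : ℝ) : ‖Complex.exp (-Complex.I * x * ξ)‖ = 1 := by
  rw [Complex.norm_exp]
  simp

/-- The multiplication formula for the Fourier transform of an integrable function. -/
theorem integral_angularFourierSchwartz_mul {f : ℝ → ℂ} (hf : Integrable f) (φ : 𝓢(ℝ, ℂ)) :
    Integrable (fun x : ℝ => φ x * ∫ ξ : ℝ, f ξ * Complex.exp (-Complex.I * ξ * x)) ∧
    ∫ ξ : ℝ, angularFourierSchwartz φ ξ * f ξ =
      ∫ x : ℝ, φ x * ∫ ξ : ℝ, f ξ * Complex.exp (-Complex.I * ξ * x) := by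
  have h0 : Integrable (fun z : ℝ × ℝ => Complex.exp (-Complex.I * z.1 * z.2) * (φ z.1 * f z.2))
      (volume.prod volume) := by
    refine (φ.integrable.mul_prod hf).bdd_mul (c := 1)
      (Measurable.aestronglyMeasurable (by fun_prop)) (Filter.Eventually.of_forall fun z => ?_)
    exact (norm_cexp_neg_I_mul _ _).le
  have h1 : ∀ x : ℝ, ∫ ξ : ℝ, Complex.exp (-Complex.I * x * ξ) * (φ x * f ξ) =
      φ x * ∫ ξ : ℝ, f ξ * Complex.exp (-Complex.I * ξ * x) := by
    intro x
    rw [← integral_const_mul]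
    refine integral_congr_ae (Filter.Eventually.of_forall fun ξ => ?_)
    simp only
    rw [show -Complex.I * (ξ : ℂ) * x = -Complex.I * x * ξ by ring]
    ring
  have h2 : ∀ ξ : ℝ, ∫ x : ℝ, Complex.exp (-Complex.I * x * ξ) * (φ x * f ξ) =
      angularFourierSchwartz φ ξ * f ξ := by
    intro ξ
    rw [angularFourierSchwartz_apply, ← integral_mul_const]
    refine integral_congr_ae (Filter.Eventually.of_forall fun x => ?_)
    simp only
    ring
  constructor
  · simpa only [h1] using h0.integral_prod_left
  · have := integral_integral_swap (f := fun x ξ : ℝ =>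
      Complex.exp (-Complex.I * x * ξ) * (φ x * f ξ)) h0
    simp_rw [h1, h2] at this
    exact this.symm

theorem isTanhKernel_tanhKernel (hα : α ∈ Ioo (0 : ℝ) 1) : IsTanhKernel α (tanhKernel α) := by
  have hi : Integrable fun x => (tanhKernel α x : ℂ) := (integrable_tanhKernel hα).ofReal
  have hL := memLp_one_iff_integrable.2 hi
  refine ⟨Lp.toTemperedDistribution hL.toLp, ?_, ?_⟩
  · intro φ
    constructor
    · exact hi.bdd_mul φ.continuous.aestronglyMeasurable
        (Filter.Eventually.of_forall fun x => φ.norm_le_seminorm ℝ x)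
    · rw [Lp.toTemperedDistribution_apply]
      refine integral_congr_ae ?_
      filter_upwards [hL.coeFn_toLp] with x hx
      rw [hx, smul_eq_mul]
  · intro φ
    have h := integral_angularFourierSchwartz_mul hi φ
    simp_rw [fourier_tanhKernel hα] at h
    refine ⟨h.1, ?_⟩
    rw [angularFourier_apply, Lp.toTemperedDistribution_apply, ← h.2]
    refine integral_congr_ae ?_
    filter_upwards [hL.coeFn_toLp] with x hx
    rw [hx, smul_eq_mul]

theorem angularFourierSchwartz_surjective : Function.Surjective angularFourierSchwartz := by
  intro ψ
  refine ⟨FourierTransformInv.fourierInv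
    (SchwartzMap.compCLMOfContinuousLinearEquiv ℂ frequencyScaling.symm ψ), ?_⟩
  rw [angularFourierSchwartz, ContinuousLinearMap.comp_apply, FourierTransform.fourierCLM_apply,
    FourierInvPair.fourier_fourierInv_eq]
  ext x
  simp

/-- Injectivity on distributions is dual to surjectivity on Schwartz functions. -/
theorem IsGivenBy.apply_eq_of_angularFourier {T S : 𝓢'(ℝ, ℂ)} {f : ℝ → ℝ} (hT : IsGivenBy (angularFourier T) f)
    (hS : IsGivenBy (angularFourier S) f) (ψ : 𝓢(ℝ, ℂ)) : T ψ = S ψ := by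
  obtain ⟨φ, rfl⟩ := angularFourierSchwartz_surjective ψ
  rw [← angularFourier_apply, ← angularFourier_apply, (hT φ).2, (hS φ).2]

/-- Test against a smooth bump equal to `1` on the given compact set. -/
theorem IsGivenBy.locallyIntegrable {T : 𝓢'(ℝ, ℂ)} {f : ℝ → ℝ} (hT : IsGivenBy T f) :
    LocallyIntegrable f := by
  rw [locallyIntegrable_iff]
  intro k hk
  obtain ⟨R, hR⟩ := hk.isBounded.subset_closedBall 0
  let b : ContDiffBump (0 : ℝ) := ⟨|R| + 1, |R| + 2, by positivity, by linarith⟩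
  have hc : HasCompactSupport fun x => (b x : ℂ) := b.hasCompactSupport.comp_left Complex.ofReal_zero
  have hd : ContDiff ℝ ∞ fun x => (b x : ℂ) := Complex.ofRealCLM.contDiff.comp b.contDiff
  have h1 := (hT (hc.toSchwartzMap hd)).1.re
  refine (h1.integrableOn (s := k)).congr_fun (fun x hx => ?_) hk.measurableSet
  have hx1 : b x = 1 := by
    refine b.one_of_mem_closedBall ?_
    refine Metric.closedBall_subset_closedBall ?_ (hR hx)
    exact (le_abs_self R).trans (by simp [b])
  simp [hx1]

theorem IsGivenBy.ae_eq {T S : 𝓢'(ℝ, ℂ)} {f g : ℝ → ℝ} (hT : IsGivenBy T f) (hS : IsGivenBy S g)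
    (h : ∀ ψ, T ψ = S ψ) : f =ᵐ[volume] g := by
  refine ae_eq_of_integral_contDiff_smul_eq hT.locallyIntegrable hS.locallyIntegrable ?_
  intro u hu hc
  have hc' : HasCompactSupport fun x => (u x : ℂ) := hc.comp_left Complex.ofReal_zero
  have hd : ContDiff ℝ ∞ fun x => (u x : ℂ) := Complex.ofRealCLM.contDiff.comp hu
  have h1 := h (hc'.toSchwartzMap hd)
  rw [(hT _).2, (hS _).2] at h1
  have e : ∀ v : ℝ → ℝ, ∫ x, (hc'.toSchwartzMap hd) x * (v x : ℂ) = ((∫ x, u x • v x : ℝ) : ℂ) := by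
    intro v
    rw [← integral_complex_ofReal]
    simp
  rw [e, e] at h1
  exact_mod_cast h1

theorem IsTanhKernel.ae_eq {K K' : ℝ → ℝ} (hK : IsTanhKernel α K) (hK' : IsTanhKernel α K') :
    K' =ᵐ[volume] K := by
  obtain ⟨T, hT, hT'⟩ := hK
  obtain ⟨S, hS, hS'⟩ := hK'
  exact hS.ae_eq hT (hS'.apply_eq_of_angularFourier hT')

end TanhKernel

theorem mainTheorem9 (α : ℝ) (hα : α ∈ Ioo (0 : ℝ) 1) :
    ∃ K : ℝ → ℝ,
      -- `K` is the kernel with the given symbol, unique up to null sets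
      (IsTanhKernel α K ∧ ∀ K' : ℝ → ℝ, IsTanhKernel α K' → K' =ᵐ[volume] K) ∧
      -- (i) smoothness away from the origin and rapid decay
      (ContDiffOn ℝ ∞ K {0}ᶜ ∧
        ∀ N : ℝ, 1 ≤ N → ∃ C : ℝ, 0 < C ∧ ∀ x : ℝ, 0 < x → |K x| ≤ C * x ^ (-N)) ∧
      -- (ii) bell-shape, in `L^p` and pointwise away from the origin, and strict convexity
      ((∀ p : ℝ≥0∞, 1 ≤ p → p < ENNReal.ofReal (1 / (1 - α)) → IsBellShaped p K) ∧
        (∀ x : ℝ, K (-x) = K x) ∧ (∀ x : ℝ, x ≠ 0 → 0 < K x) ∧ StrictAntiOn K (Ioi 0) ∧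
        StrictConvexOn ℝ (Ioi 0) K ∧ StrictConvexOn ℝ (Iio 0) K) ∧
      -- (iii) unit norm
      (eLpNorm K 1 = 1 ∧ (∫ x : ℝ, K x) = tanhSymbol α 0 ∧ tanhSymbol α 0 = 1 ∧
        ∀ p : ℝ≥0∞, 1 ≤ p → IsLeast {C : ℝ≥0∞ | IsConvolutionBound K p C} 1) ∧
      -- (iv) integrability
      (∀ p : ℝ≥0∞, 0 < p → (MemLp K p ↔ p < ENNReal.ofReal (1 / (1 - α)))) := by
  have hi := integrable_tanhKernel hα
  have hnn : 0 ≤ tanhKernel α := tanhKernel_nonneg α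
  have h1 := integral_tanhKernel hα
  have h0 : tanhSymbol α 0 = 1 := if_pos rfl
  have hK := isTanhKernel_tanhKernel hα
  refine ⟨tanhKernel α, ⟨hK, fun K' hK' => hK.ae_eq hK'⟩, ⟨contDiffOn_tanhKernel hα, fun N hN => ?_⟩,
    ⟨fun p hp hp' => isBellShaped_tanhKernel hα hp hp', tanhKernel_neg α,
      fun x hx => tanhKernel_pos hα hx, strictAntiOn_tanhKernel hα,
      strictConvexOn_tanhKernel_Ioi hα, strictConvexOn_tanhKernel_Iio hα⟩,
    ⟨?_, h1.trans h0.symm, h0, fun p hp =>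
      ⟨isConvolutionBound_one (measurable_tanhKernel α) hi hnn h1 hp, fun C hC =>
        one_le_of_isConvolutionBound hi hnn h1 hp hC⟩⟩,
    fun p hp => ⟨lt_of_memLp_tanhKernel hα, memLp_tanhKernel hα hp⟩⟩
  · obtain ⟨C, hC, hb⟩ := tanhKernel_le_rpow hα (β := N) (by linarith [hα.1])
    refine ⟨C, hC, fun x hx => ?_⟩
    rw [abs_of_nonneg (tanhKernel_nonneg α x)]
    exact hb x hx
  · have := lintegral_ofReal_sub_left hi hnn h1 0
    rw [lintegral_sub_left_eq_self (fun y => ENNReal.ofReal (tanhKernel α y)) 0] at this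
    rw [eLpNorm_one_eq_lintegral_enorm, ← this]
    exact lintegral_congr fun x => Real.enorm_of_nonneg (tanhKernel_nonneg α x)
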